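/- Let $q\in\mathbb C$ with $0<|q|<1$. Write $(x;q)_\infty=\prod_{k\ge 0}(1-xq^k)$, $(x;q)_n=\prod_{k=0}^{n-1}(1-xq^k)$, $(x_1,\dots,x_m;q)_n=(x_1;q)_n\cdots(x_m;q)_n$ for $n\in\mathbb N\cup\{\infty\}$, and $${}_r\phi_s\!\left[\begin{matrix}a_1,\dots,a_r\\ b_1,\dots,b_s\end{matrix};q,z\right]=\sum_{k=0}^\infty\frac{(a_1,\dots,a_r;q)_k}{(b_1,\dots,b_s;q)_k}\frac{z^k}{(q;q)_k}\left((-1)^kq^{\binom k2}\right)^{s-r+1}.$$ Let $a,b,c,d,e,f$ be nonzero complex numbers and put $\lambda=qa^2/bcd$ and $\mu=q^2a^3/b^2cdef$; let $a^{1/2},\lambda^{1/2},\mu^{1/2}$ be any square roots of $a,\lambda,\mu$. Then $${}_8\phi_7\!\left[\begin{matrix}a,qa^{1/2},-qa^{1/2},b,c,d,e,f\\ a^{1/2},-a^{1/2},aq/b,aq/c,aq/d,aq/e,aq/f\end{matrix};q,\frac{a^2q^2}{bcdef}\right]$$ $$=\frac{(aq,aq/ef,\lambda q/e,\lambda q/f;q)_\infty}{(aq/e,aq/f,\lambda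 q,\lambda q/ef;q)_\infty}\;{}_8\phi_7\!\left[\begin{matrix}\lambda,q\lambda^{1/2},-q\lambda^{1/2},\lambda b/a,\lambda c/a,\lambda d/a,e,f\\ \lambda^{1/2},-\lambda^{1/2},aq/b,aq/c,aq/d,\lambda q/e,\lambda q/f\end{matrix};q,\frac{aq}{ef}\right]\qquad(1)$$ and $${}_8\phi_7\!\left[\begin{matrix}a,qa^{1/2},-qa^{1/2},b,c,d,e,f\\ a^{1/2},-a^{1/2},aq/b,aq/c,aq/d,aq/e,aq/f\end{matrix};q,\frac{a^2q^2}{bcdef}\right]$$ $$=\frac{(aq,b,bc\mu/a,bd\mu/a,be\mu/a,bf\mu/a;q)_\infty}{(aq/c,aq/d,aq/e,aq/f,\mu q,b\mu/a;q)_\infty}\;{}_8\phi_7\!\left[\begin{matrix}\mu,q\mu^{1/2},-q\mu^{1/2},aq/bc,aq/bd,aq/be,aq/bf,b\mu/a\\ \mu^{1/2},-\mu^{1/2},bc\mu/a,bd\mu/a,be\mu/a,bf\mu/a,aq/b\end{matrix};q,b\right].\qquad(2)$$ Each of (1) and (2) holds whenever the two series in it converge and the expressions in it are defined, that is, no lower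 parameter of either series is of the form $q^{-n}$ with $n\ge 0$ an integer, and the infinite product in the denominator of the prefactor is nonzero. -/

import Mathlib

/-- The infinite `q`-shifted factorial `(x; q)_∞ = ∏_{k ≥ 0} (1 - x q^k)`. -/
noncomputable def qPochInf (x q : ℂ) : ℂ := ∏' k : ℕ, (1 - x * q ^ k)

/-- The finite `q`-shifted factorial `(x; q)_n = ∏_{k < n} (1 - x q^k)`, for `n : ℕ`. -/
noncomputable def qPoch (x q : ℂ) (n : ℕ) : ℂ := ∏ k ∈ Finset.range n, (1 - x * q ^ k)

/-- For `|q| < 1` the infinite product is genuinely convergent. -/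
theorem multipliable_qPochInf (x : ℂ) {q : ℂ} (hq : ‖q‖ < 1) :
    Multipliable fun k : ℕ => (1 - x * q ^ k) := by
  have h : Summable fun k : ℕ => ‖-(x * q ^ k)‖ := by
    simp only [norm_neg, norm_mul, norm_pow]
    exact (summable_geometric_of_lt_one (norm_nonneg q) hq).mul_left _
  simpa [sub_eq_add_neg] using multipliable_one_add_of_summable h

/-- `(x; q)_n (x qⁿ; q)_∞ = (x; q)_∞`, so the finite symbol is the quotient
`(x; q)_∞ / (x qⁿ; q)_∞` whenever that quotient makes sense. -/
theorem qPoch_mul_qPochInf (x : ℂ) {q : ℂ} (hq : ‖q‖ < 1) (n : ℕ) :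
    qPoch x q n * qPochInf (x * q ^ n) q = qPochInf x q := by
  unfold qPoch qPochInf
  have h : Multipliable fun k : ℕ => (1 - x * q ^ (k + n)) := by
    have := multipliable_qPochInf (x * q ^ n) hq
    refine this.congr fun k => ?_
    ring
  rw [← Multipliable.prod_mul_tprod_nat_mul' (f := fun k : ℕ => (1 - x * q ^ k)) h]
  congr 1
  exact tprod_congr fun k => by ring

/-- `(x₁, …, x_m; q)_∞`. -/
noncomputable def qPochInfs (xs : List ℂ) (q : ℂ) : ℂ := (xs.map fun x => qPochInf x q).prod

/-- `(x₁, …, x_m; q)_n`. -/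
noncomputable def qPochs (xs : List ℂ) (q : ℂ) (n : ℕ) : ℂ := (xs.map fun x => qPoch x q n).prod

/-- The `k`-th term of the basic hypergeometric series `_rφ_s` with upper parameters `as`
(`r = as.length`), lower parameters `bs` (`s = bs.length`), base `q` and argument `z`. -/
noncomputable def phiTerm (as bs : List ℂ) (q z : ℂ) (k : ℕ) : ℂ :=
  qPochs as q k / qPochs bs q k * (z ^ k / qPoch q q k) *
    ((-1) ^ k * q ^ (k.choose 2)) ^ ((bs.length : ℤ) - (as.length : ℤ) + 1)

/-- The basic hypergeometric series `_rφ_s[as; bs; q, z]`. -/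
noncomputable def phi (as bs : List ℂ) (q z : ℂ) : ℂ := ∑' k : ℕ, phiTerm as bs q z k

/-- The series `_rφ_s[as; bs; q, z]` is meaningful: no lower parameter is of the form `q^{-n}`
with `n ≥ 0` (so no term has a zero denominator), and the series converges. -/
def PhiConverges (as bs : List ℂ) (q z : ℂ) : Prop :=
  (∀ x ∈ bs, ∀ n : ℕ, x * q ^ n ≠ 1) ∧ Summable (phiTerm as bs q z)

/-! Both transformations are Bailey's. The engine is Jackson's terminating very-well-poised sum
(`sum_jacksonTerm`), proved by telescoping; its degenerate case `t = 0` is the terminating ₆φ₅ sum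
(`sum_six_phi_five`). For (1) with `f = q ^ (-n)`, Jackson's sum with base `lam` expands the ratio
of the `b, c, d` factorials in the `k`-th term as a sum over `j ≤ k` (`sum_jackson_expansion`).
After the order of summation is exchanged, each inner sum is a ₆φ₅ (`sum_poised_inner`), which gives
`sum_poisedTerm_transformation`.

General `f` is reached by analytic continuation in `w = 1 / f`. Homogenizing `(f; q)_k` to `qDiff w
1 q k` and multiplying by infinite products to clear the poles makes both sides holomorphic on a
disc about `0`. They agree at `w = q ^ n` for all large `n`, and these points accumulate at `0`, so
the identity theorem applies (`regularized_transformation`).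

For (2), transformation (1) is applied twice, the second time with the parameters regrouped so that
the base becomes `mu`. The intermediate series need not converge or be defined under the hypotheses
of (2), so `c, e` are replaced by `c / w, e / w`. For small `w ≠ 0` every intermediate condition
holds, and the identity theorem carries the result to `w = 1` (`second_transformation_scaled`,
`second_transformation`).

Convergence means that the argument has norm less than one or that the series terminates
(`norm_lt_one_or_hasTerminator`). Terminating series have finitely supported coefficients, so they
fit the same continuation argument; for (2), the symmetry in `c, d, e, f` moves the terminating
parameters to positions that the scaling leaves fixed. -/

/-- The homogeneous shifted factorial `∏_{k < n} (w - x q^k)`. -/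
noncomputable def qDiff (w x q : ℂ) (n : ℕ) : ℂ := ∏ k ∈ Finset.range n, (w - x * q ^ k)

/-- The very-well-poised factor `(1 - a q^{2k}) (aq; q)_{k-1}`, equal to `1` for `k = 0`. -/
noncomputable def vwp (a q : ℂ) : ℕ → ℂ
  | 0 => 1
  | k + 1 => (1 - a * q ^ (2 * k + 2)) * qPoch (a * q) q k

/-! ### Finite shifted factorials and their splittings. -/

section Finite

variable (w x q : ℂ)

@[simp] theorem qPoch_zero : qPoch x q 0 = 1 := by simp [qPoch]

@[simp] theorem qDiff_zero : qDiff w x q 0 = 1 := by simp [qDiff]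

@[simp] theorem vwp_zero : vwp x q 0 = 1 := rfl

theorem vwp_succ (k : ℕ) : vwp x q (k + 1) = (1 - x * q ^ (2 * k + 2)) * qPoch (x * q) q k := rfl

theorem qPoch_succ (n : ℕ) : qPoch x q (n + 1) = qPoch x q n * (1 - x * q ^ n) := by
  simp [qPoch, Finset.prod_range_succ]

theorem qDiff_succ (n : ℕ) : qDiff w x q (n + 1) = qDiff w x q n * (w - x * q ^ n) := by
  simp [qDiff, Finset.prod_range_succ]

theorem qPoch_add (m n : ℕ) : qPoch x q (m + n) = qPoch x q m * qPoch (x * q ^ m) q n := by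
  simp only [qPoch, Finset.prod_range_add, pow_add, mul_assoc]

theorem qPoch_succ_left (n : ℕ) : qPoch x q (n + 1) = (1 - x) * qPoch (x * q) q n := by
  rw [add_comm, qPoch_add]
  simp [qPoch]

theorem qDiff_add (m n : ℕ) :
    qDiff w x q (m + n) = qDiff w x q m * qDiff w (x * q ^ m) q n := by
  simp only [qDiff, Finset.prod_range_add, pow_add, mul_assoc]

theorem qDiff_one : qDiff 1 x q = qPoch x q := by
  ext n
  simp [qDiff, qPoch]

theorem qDiff_mul (y : ℂ) (n : ℕ) : qDiff (y * w) (y * x) q n = y ^ n * qDiff w x q n := by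
  simp only [qDiff]
  rw [← Finset.card_range n, ← Finset.prod_const, Finset.card_range, ← Finset.prod_mul_distrib]
  exact Finset.prod_congr rfl fun k _ => by ring

/-- This is the reason for `qDiff`: the right side is polynomial in `w`, so a parameter `x / w` can
be followed to `w = 0`, where it becomes infinite. -/
theorem pow_mul_qPoch_div (hw : w ≠ 0) (n : ℕ) : w ^ n * qPoch (x / w) q n = qDiff w x q n := by
  have := qDiff_mul 1 (x / w) q w n
  rw [qDiff_one] at this
  rw [← this, mul_one, mul_div_cancel₀ _ hw]

theorem qPoch_eq_zero_of_le {x q : ℂ} {m n : ℕ} (h : x * q ^ m = 1) (hmn : m < n) :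
    qPoch x q n = 0 :=
  Finset.prod_eq_zero (Finset.mem_range.2 hmn) (by simp [h])

theorem qPoch_ne_zero {x q : ℂ} (h : ∀ n : ℕ, x * q ^ n ≠ 1) (n : ℕ) : qPoch x q n ≠ 0 :=
  Finset.prod_ne_zero_iff.2 fun k _ => sub_ne_zero.2 (h k).symm

/-- Unless `j + i = 0`, both sides equal `(1 - a q^{2(j+i)}) (aq; q)_{2j+i-1}`. Shifting the index
by `j` thus turns the base `a` into `a q^{2j}`, as the inner ₆φ₅ requires. -/
theorem vwp_add_mul_qPoch (a : ℂ) (j i : ℕ) :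
    vwp a q (j + i) * qPoch (a * q ^ (j + i)) q j
      = qPoch (a * q) q (2 * j) * vwp (a * q ^ (2 * j)) q i := by
  rcases Nat.eq_zero_or_pos (j + i) with h0 | h0
  · obtain ⟨rfl, rfl⟩ := Nat.add_eq_zero_iff.1 h0
    simp
  obtain ⟨m, hm⟩ : ∃ m, j + i = m + 1 := ⟨j + i - 1, by omega⟩
  have e1 : vwp a q (j + i) * qPoch (a * q ^ (j + i)) q j
      = (1 - a * q ^ (2 * (j + i))) * qPoch (a * q) q (m + j) := by
    rw [qPoch_add, hm, vwp_succ]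
    ring_nf
  rw [e1]
  cases i with
  | zero =>
    obtain ⟨l, rfl⟩ : ∃ l, j = l + 1 := ⟨j - 1, by omega⟩
    have : 2 * (l + 1) = (m + (l + 1)) + 1 := by omega
    rw [vwp_zero, mul_one, this, qPoch_succ, ← this]
    have h2 : m + (l + 1) + 1 = 2 * (l + 1 + 0) := by omega
    rw [← h2]
    ring
  | succ i =>
    have : m + j = 2 * j + i := by omega
    rw [this, qPoch_add, vwp_succ]
    ring_nf

/-- `vwp` is the usual very-well-poised factor with the division by `1 - a` carried out, hence
polynomial in `a`. -/
theorem qPoch_mul_self_eq (a : ℂ) (n : ℕ) :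
    qPoch a q n * (1 - a * q ^ (2 * n)) = (1 - a) * vwp a q n := by
  cases n with
  | zero => simp
  | succ n => rw [qPoch_succ_left, vwp_succ]; ring

end Finite

/-! ### Infinite products: zeros, holomorphy and growth bounds. -/

section Infinite

variable {q : ℂ}

theorem summable_norm_mul_pow (hq : ‖q‖ < 1) (x : ℂ) : Summable fun k : ℕ => ‖-(x * q ^ k)‖ := by
  simp only [norm_neg, norm_mul, norm_pow]
  exact (summable_geometric_of_lt_one (norm_nonneg q) hq).mul_left _

theorem qPochInf_ne_zero_iff (hq : ‖q‖ < 1) {x : ℂ} :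
    qPochInf x q ≠ 0 ↔ ∀ n : ℕ, x * q ^ n ≠ 1 := by
  constructor
  · intro h n hn
    refine h ?_
    rw [← qPoch_mul_qPochInf x hq (n + 1), qPoch_eq_zero_of_le hn (Nat.lt_succ_self n), zero_mul]
  · intro h
    have := tprod_one_add_ne_zero_of_summable (f := fun k : ℕ => -(x * q ^ k))
      (fun i => by rw [← sub_eq_add_neg]; exact sub_ne_zero.2 (h i).symm)
      (summable_norm_mul_pow hq x)
    simpa [qPochInf, sub_eq_add_neg] using this

theorem mul_pow_ne_one_of_norm_lt {x : ℂ} (hq : ‖q‖ < 1) (hx : ‖x‖ < 1) (n : ℕ) :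
    x * q ^ n ≠ 1 := by
  intro h
  have h1 : ‖x * q ^ n‖ < 1 := by
    rw [norm_mul, norm_pow]
    calc ‖x‖ * ‖q‖ ^ n ≤ ‖x‖ * 1 := by
          gcongr; exact pow_le_one₀ (norm_nonneg _) hq.le
      _ < 1 := by simpa
  rw [h] at h1
  simp at h1

theorem differentiable_qPochInf (hq : ‖q‖ < 1) : Differentiable ℂ fun x => qPochInf x q := by
  have h : HasProdLocallyUniformlyOn (fun (k : ℕ) (x : ℂ) => 1 + -(x * q ^ k))
      (fun x => ∏' k : ℕ, (1 + -(x * q ^ k))) Set.univ := by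
    apply hasProdLocallyUniformlyOn_of_forall_compact isOpen_univ
    intro K _ hcK
    obtain ⟨V, hV⟩ := hcK.isBounded.exists_norm_le
    refine ((summable_geometric_of_lt_one (norm_nonneg q) hq).mul_left
      V).hasProdUniformlyOn_nat_one_add hcK (.of_forall fun n x hx ↦ ?_) (fun _ ↦ by fun_prop)
    rw [norm_neg, norm_mul, norm_pow]
    gcongr
    exact hV x hx
  have h2 := h.differentiableOn
    (.of_forall fun _ ↦ by simpa [Finset.prod_fn] using
      DifferentiableOn.finsetProd (fun _ _ ↦ by fun_prop)) isOpen_univ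
  simpa [qPochInf, sub_eq_add_neg, differentiableOn_univ] using h2

theorem tendsto_qPoch (hq : ‖q‖ < 1) (x : ℂ) :
    Filter.Tendsto (qPoch x q) Filter.atTop (nhds (qPochInf x q)) :=
  (multipliable_qPochInf x hq).hasProd.tendsto_prod_nat

theorem exists_norm_inv_qPoch_le (hq : ‖q‖ < 1) {x : ℂ} (hx : ∀ n : ℕ, x * q ^ n ≠ 1) :
    ∃ C : ℝ, 0 ≤ C ∧ ∀ k, ‖(qPoch x q k)⁻¹‖ ≤ C := by
  have h := ((tendsto_qPoch hq x).inv₀ ((qPochInf_ne_zero_iff hq).2 hx)).norm.bddAbove_range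
  obtain ⟨C, hC⟩ := h
  exact ⟨C, (norm_nonneg _).trans (hC ⟨0, rfl⟩), fun k => hC ⟨k, rfl⟩⟩

/-- Each factor is at most `U (1 + (V / U) |q|^i)`, and the product of the parentheses converges.
The geometric rate is therefore exactly the bound `U` on `w`, with a constant uniform in `w` and
`x`. -/
theorem exists_norm_qDiff_le (hq : ‖q‖ < 1) {U V : ℝ} (hU : 0 < U) (hV : 0 ≤ V) :
    ∃ C : ℝ, 0 ≤ C ∧ ∀ (w x : ℂ), ‖w‖ ≤ U → ‖x‖ ≤ V → ∀ k, ‖qDiff w x q k‖ ≤ C * U ^ k := by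
  have hs := (summable_geometric_of_lt_one (norm_nonneg q) hq).mul_left (V / U)
  refine ⟨Real.exp (∑' k : ℕ, V / U * ‖q‖ ^ k), (Real.exp_pos _).le, fun w x hw hx k => ?_⟩
  calc ‖qDiff w x q k‖ ≤ ∏ i ∈ Finset.range k, (Real.exp (V / U * ‖q‖ ^ i) * U) := by
        rw [qDiff, norm_prod]
        refine Finset.prod_le_prod (fun _ _ => norm_nonneg _) fun i _ => ?_
        calc ‖w - x * q ^ i‖ ≤ ‖w‖ + ‖x‖ * ‖q‖ ^ i := by
              refine (norm_sub_le _ _).trans ?_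
              rw [norm_mul, norm_pow]
          _ ≤ U + V * ‖q‖ ^ i := by gcongr
          _ = (V / U * ‖q‖ ^ i + 1) * U := by field_simp; ring
          _ ≤ _ := by gcongr; exact Real.add_one_le_exp _
    _ = Real.exp (∑ i ∈ Finset.range k, V / U * ‖q‖ ^ i) * U ^ k := by
        rw [Finset.prod_mul_distrib, Real.exp_sum]
        simp
    _ ≤ _ := by
        gcongr
        exact hs.sum_le_tsum _ fun i _ => by positivity

end Infinite

/-! ### Holomorphic sequences with geometric bounds, and their sums. -/

section GeomAnalytic

/-- A sequence of holomorphic functions on `s` bounded by a constant times `r ^ k`. -/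
structure GeomAnalytic (F : ℕ → ℂ → ℂ) (s : Set ℂ) (r : ℝ) : Prop where
  diff : ∀ k, DifferentiableOn ℂ (F k) s
  bound : ∃ C : ℝ, 0 ≤ C ∧ ∀ k, ∀ w ∈ s, ‖F k w‖ ≤ C * r ^ k

variable {F G : ℕ → ℂ → ℂ} {s : Set ℂ} {r r' : ℝ} {q : ℂ}

theorem GeomAnalytic.mul (hF : GeomAnalytic F s r) (hG : GeomAnalytic G s r') :
    GeomAnalytic (fun k w => F k w * G k w) s (r * r') := by
  refine ⟨fun k => (hF.diff k).mul (hG.diff k), ?_⟩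
  obtain ⟨C, hC, h⟩ := hF.bound
  obtain ⟨C', hC', h'⟩ := hG.bound
  refine ⟨C * C', mul_nonneg hC hC', fun k w hw => ?_⟩
  rw [norm_mul, mul_pow]
  calc ‖F k w‖ * ‖G k w‖ ≤ (C * r ^ k) * (C' * r' ^ k) :=
        mul_le_mul (h k w hw) (h' k w hw) (norm_nonneg _) ((norm_nonneg _).trans (h k w hw))
    _ = _ := by ring

theorem GeomAnalytic.const {c : ℕ → ℂ} (s : Set ℂ)
    (hc : ∃ C : ℝ, 0 ≤ C ∧ ∀ k, ‖c k‖ ≤ C * r ^ k) : GeomAnalytic (fun k _ => c k) s r :=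
  ⟨fun _ => differentiableOn_const _, by
    obtain ⟨C, hC, h⟩ := hc
    exact ⟨C, hC, fun k _ _ => h k⟩⟩

theorem GeomAnalytic.differentiableOn_tsum (hF : GeomAnalytic F s r) (hs : IsOpen s)
    (hr0 : 0 ≤ r) (hr : r < 1) : DifferentiableOn ℂ (fun w => ∑' k, F k w) s := by
  obtain ⟨C, hC, h⟩ := hF.bound
  exact Complex.differentiableOn_tsum_of_summable_norm
    ((summable_geometric_of_lt_one hr0 hr).mul_left C) hF.diff hs h

theorem geomAnalytic_qDiff (hq : ‖q‖ < 1) {U V : ℝ} (hU : 0 < U) {f g : ℂ → ℂ}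
    (hf : DifferentiableOn ℂ f s) (hg : DifferentiableOn ℂ g s)
    (hfU : ∀ w ∈ s, ‖f w‖ ≤ U) (hgV : ∀ w ∈ s, ‖g w‖ ≤ V) :
    GeomAnalytic (fun k w => qDiff (f w) (g w) q k) s U := by
  refine ⟨fun k => ?_, ?_⟩
  · unfold qDiff
    exact DifferentiableOn.fun_finsetProd fun i _ => hf.sub (hg.mul_const _)
  · obtain ⟨C, hC, h⟩ := exists_norm_qDiff_le hq hU (le_max_left 0 V)
    exact ⟨C, hC, fun k w hw => h _ _ (hfU w hw) ((hgV w hw).trans (le_max_right _ _)) k⟩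

theorem geomAnalytic_qPoch (hq : ‖q‖ < 1) {V : ℝ} {g : ℂ → ℂ}
    (hg : DifferentiableOn ℂ g s) (hgV : ∀ w ∈ s, ‖g w‖ ≤ V) :
    GeomAnalytic (fun k w => qPoch (g w) q k) s 1 := by
  have := geomAnalytic_qDiff hq one_pos (differentiableOn_const (1 : ℂ)) hg (by simp) hgV
  simpa only [qDiff_one] using this

theorem norm_mul_pow_le (hq : ‖q‖ < 1) {V : ℝ} {x : ℂ} (hx : ‖x‖ ≤ V) (k : ℕ) :
    ‖x * q ^ k‖ ≤ V := by
  rw [norm_mul, norm_pow]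
  exact (mul_le_of_le_one_right (norm_nonneg _) (pow_le_one₀ (norm_nonneg _) hq.le)).trans hx

theorem geomAnalytic_qPochInf (hq : ‖q‖ < 1) {V : ℝ} {g : ℂ → ℂ}
    (hg : DifferentiableOn ℂ g s) (hgV : ∀ w ∈ s, ‖g w‖ ≤ V) :
    GeomAnalytic (fun k w => qPochInf (g w * q ^ k) q) s 1 := by
  refine ⟨fun k => ?_, ?_⟩
  · exact (differentiable_qPochInf hq).comp_differentiableOn (hg.mul_const _)
  -- All arguments `g w * q ^ k` stay in one closed ball of radius `V`, so a single compactness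
  -- bound serves every `k`.
  · obtain ⟨C, hC⟩ := (isCompact_closedBall (0 : ℂ) V).exists_bound_of_continuousOn
      (differentiable_qPochInf hq).continuous.continuousOn
    refine ⟨max 0 C, le_max_left _ _, fun k w hw => ?_⟩
    rw [one_pow, mul_one]
    exact (hC _ (by simpa using norm_mul_pow_le hq (hgV w hw) k)).trans (le_max_right _ _)

theorem geomAnalytic_vwp (hq : ‖q‖ < 1) {V : ℝ} {g : ℂ → ℂ}
    (hg : DifferentiableOn ℂ g s) (hgV : ∀ w ∈ s, ‖g w‖ ≤ V) :
    GeomAnalytic (fun k w => vwp (g w) q k) s 1 := by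
  have h := geomAnalytic_qPoch hq (hg.mul_const q) (V := V)
    fun w hw => by simpa using norm_mul_pow_le hq (hgV w hw) 1
  refine ⟨fun k => ?_, ?_⟩
  · cases k with
    | zero => exact differentiableOn_const _
    | succ k => exact ((hg.mul_const _).const_sub 1).mul (h.diff k)
  · obtain ⟨C, hC, hb⟩ := h.bound
    refine ⟨max 1 ((1 + V) * C), le_trans zero_le_one (le_max_left _ _), fun k w hw => ?_⟩
    rw [one_pow, mul_one]
    cases k with
    | zero => simp
    | succ k =>
      refine le_trans ?_ (le_max_right _ _)
      rw [vwp_succ, norm_mul]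
      have h1 := hb k w hw
      rw [one_pow, mul_one] at h1
      have h2 : ‖1 - g w * q ^ (2 * k + 2)‖ ≤ 1 + V :=
        (norm_sub_le _ _).trans (by simpa using norm_mul_pow_le hq (hgV w hw) (2 * k + 2))
      exact mul_le_mul h2 h1 (norm_nonneg _) ((norm_nonneg _).trans h2)

end GeomAnalytic

/-! ### Jackson's sum by telescoping. -/

section Jackson

/-- The summand of Jackson's terminating very-well-poised sum, with `a = u b c`. -/
noncomputable def jacksonTerm (b c u t q : ℂ) (n k r : ℕ) : ℂ :=
  vwp (u * b * c) q k * qPoch b q k * qPoch c q k * qDiff t u q k * q ^ k *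
      qPoch (u * b * c * t * q ^ (n + 1)) q k * qPoch (t * q) q r /
    (qPoch q q k * qPoch (u * c * q) q k * qPoch (u * b * q) q k * qPoch (t * b * c * q) q k *
      qPoch (u * b * c * q ^ (n + 1)) q k * qPoch q q r)

/-- The antidifference in Jackson's sum. -/
noncomputable def jacksonAnti (b c u t q : ℂ) (n k r : ℕ) : ℂ :=
  -q ^ (n + 1) * (1 - u * b * c * t * (q ^ (n + 1)) ^ 2) *
    (qPoch (u * b * c * q) q k * qPoch b q (k + 1) * qPoch c q (k + 1) * qDiff t u q (k + 1) *
      qPoch (u * b * c * t * q ^ (n + 2)) q k * qPoch (t * q) q r) /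
    (qPoch q q k * qPoch (u * c * q) q k * qPoch (u * b * q) q k * qPoch (t * b * c * q) q k *
      qPoch (u * b * c * q ^ (n + 2)) q k * qPoch q q r)

/-- The telescoping certificate with all common factors removed, where `X = q ^ (k + 1)`, `Z = q ^
(r + 1)` and `X * Z = q ^ (n + 1)` for `n = k + 1 + r`. -/
theorem jackson_polynomial_identity (b c u t X Z : ℂ) :
    (1 - u * b * c * t * X * (X * Z)) * (1 - t * Z) * (1 - X * Z) * (1 - u * c * (X * Z)) *
        (1 - u * b * (X * Z)) * (1 - t * b * c * (X * Z)) * (1 - u * b * c * X ^ 2) -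
      (1 - u * b * c * t * (X * Z)) * (1 - Z) * (1 - u * b * c * X * (X * Z)) *
        (1 - u * (X * Z)) * (1 - t * c * (X * Z)) * (1 - t * b * (X * Z)) *
        (1 - u * b * c * X ^ 2) =
    -Z * (1 - u * b * c * t * (X * Z) ^ 2) *
      ((1 - u * b * c * X) * (1 - b * X) * (1 - c * X) * (t - u * X) *
          (1 - u * b * c * t * X * (X * Z)) * (1 - Z) -
        (1 - X) * (1 - u * c * X) * (1 - u * b * X) * (1 - t * b * c * X) * (1 - t * Z) *
          (1 - u * b * c * X * (X * Z))) := by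
  ring

theorem jackson_rational_identity (b c u t X Z G : ℂ) (h1 : 1 - X ≠ 0) (h2 : 1 - u * c * X ≠ 0)
    (h3 : 1 - u * b * X ≠ 0) (h4 : 1 - t * b * c * X ≠ 0)
    (h5 : 1 - u * b * c * X * (X * Z) ≠ 0) (h6 : 1 - Z ≠ 0) (h7 : 1 - u * b * c * (X * Z) ≠ 0) :
    -(X * Z) * (1 - u * b * c * t * (X * Z) ^ 2) * (G * ((1 - t * Z) / (1 - Z))) +
      ((1 - X * Z) * (1 - u * c * (X * Z)) * (1 - u * b * (X * Z)) * (1 - t * b * c * (X * Z)) *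
        (G * ((1 - u * b * c * X ^ 2) * X * (1 - u * b * c * t * X * (X * Z)) * (1 - t * Z) /
          ((1 - X) * (1 - u * c * X) * (1 - u * b * X) * (1 - t * b * c * X) *
            (1 - u * b * c * X * (X * Z)) * (1 - Z)))) -
      (1 - u * b * c * (X * Z)) * (1 - u * (X * Z)) * (1 - t * c * (X * Z)) *
        (1 - t * b * (X * Z)) *
        (G * ((1 - u * b * c * X ^ 2) * X * (1 - u * b * c * t * (X * Z)) /
          ((1 - X) * (1 - u * c * X) * (1 - u * b * X) * (1 - t * b * c * X) *
            (1 - u * b * c * (X * Z)))))) =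
    -(X * Z) * (1 - u * b * c * t * (X * Z) ^ 2) *
      (G * ((1 - u * b * c * X) * (1 - b * X) * (1 - c * X) * (t - u * X) *
        (1 - u * b * c * t * X * (X * Z)) /
          ((1 - X) * (1 - u * c * X) * (1 - u * b * X) * (1 - t * b * c * X) *
            (1 - u * b * c * X * (X * Z))))) := by
  have key := jackson_polynomial_identity b c u t X Z
  generalize 1 - u * b * c * X * (X * Z) = d5 at *
  generalize 1 - u * b * c * (X * Z) = d7 at *
  generalize 1 - u * b * c * t * (X * Z) ^ 2 = e1 at *
  generalize 1 - u * b * c * t * X * (X * Z) = e2 at *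
  generalize 1 - u * b * c * t * (X * Z) = e3 at *
  generalize 1 - X * Z = e4 at *
  generalize 1 - u * c * (X * Z) = e5 at *
  generalize 1 - u * b * (X * Z) = e6 at *
  generalize 1 - t * b * c * (X * Z) = e7 at *
  generalize 1 - u * (X * Z) = e8 at *
  generalize 1 - t * c * (X * Z) = e9 at *
  generalize 1 - t * b * (X * Z) = e10 at *
  generalize 1 - u * b * c * X ^ 2 = e11 at *
  generalize 1 - u * b * c * X = e12 at *
  generalize 1 - t * Z = e13 at *
  generalize 1 - X = d1 at *
  generalize 1 - u * c * X = d2 at *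
  generalize 1 - u * b * X = d3 at *
  generalize 1 - t * b * c * X = d4 at *
  generalize 1 - Z = d6 at *
  generalize 1 - b * X = e14 at *
  generalize 1 - c * X = e15 at *
  generalize t - u * X = e16 at *
  field_simp
  linear_combination X * G * key

variable {b c u t q : ℂ}

/-- The four terms share one factor `G`; their quotients by `G` are rational in `q ^ (k + 1)` and `q
^ (r + 1)`, which reduces the claim to `jackson_rational_identity`. The index `r` stands for `n -
k`, so it drops as `k` grows. -/
theorem jacksonAnti_step (hq : ∀ n : ℕ, q * q ^ n ≠ 1) (hc : ∀ n : ℕ, u * c * q * q ^ n ≠ 1)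
    (hb : ∀ n : ℕ, u * b * q * q ^ n ≠ 1) (hbc : ∀ n : ℕ, t * b * c * q * q ^ n ≠ 1)
    (ha : ∀ n : ℕ, u * b * c * q * q ^ n ≠ 1) (n k r : ℕ) (hn : n = k + 1 + r) :
    jacksonAnti b c u t q n k (r + 1) +
      ((1 - q ^ (n + 1)) * (1 - u * c * q ^ (n + 1)) * (1 - u * b * q ^ (n + 1)) *
          (1 - t * b * c * q ^ (n + 1)) * jacksonTerm b c u t q (n + 1) (k + 1) (r + 1) -
        (1 - u * b * c * q ^ (n + 1)) * (1 - u * q ^ (n + 1)) * (1 - t * c * q ^ (n + 1)) *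
          (1 - t * b * q ^ (n + 1)) * jacksonTerm b c u t q n (k + 1) r) =
    jacksonAnti b c u t q n (k + 1) r := by
  have hy : q ^ (n + 1) = q ^ (k + 1) * q ^ (r + 1) := by rw [hn]; ring
  have ne : ∀ {x : ℂ}, (∀ n : ℕ, x * q * q ^ n ≠ 1) → ∀ m : ℕ, 1 - x * q ^ (m + 1) ≠ 0 := by
    intro x hx m
    have := sub_ne_zero.2 (hx m).symm
    rwa [pow_succ', ← mul_assoc]
  have ne1 : ∀ m : ℕ, 1 - q ^ (m + 1) ≠ 0 := by
    intro m
    have := ne (x := 1) (by simpa using hq) m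
    simpa using this
  have e1 : jacksonAnti b c u t q n k (r + 1) =
      -(q ^ (n + 1)) * (1 - u * b * c * t * (q ^ (n + 1)) ^ 2) *
      ((qPoch (u * b * c * q) q k * qPoch b q (k + 1) * qPoch c q (k + 1) * qDiff t u q (k + 1) *
      qPoch (u * b * c * t * q ^ (n + 2)) q k * qPoch (t * q) q r /
    (qPoch q q k * qPoch (u * c * q) q k * qPoch (u * b * q) q k * qPoch (t * b * c * q) q k *
      qPoch (u * b * c * q ^ (n + 2)) q k * qPoch q q r)) *
      ((1 - t * q ^ (r + 1)) / (1 - q ^ (r + 1)))) := by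
    rw [jacksonAnti, qPoch_succ (t * q), qPoch_succ q]
    simp only [div_eq_mul_inv, mul_inv]
    rw [show t * q * q ^ r = t * q ^ (r + 1) by ring, show q * q ^ r = q ^ (r + 1) by ring]
    ring
  have e2 : jacksonTerm b c u t q (n + 1) (k + 1) (r + 1) =
      (qPoch (u * b * c * q) q k * qPoch b q (k + 1) * qPoch c q (k + 1) * qDiff t u q (k + 1) *
      qPoch (u * b * c * t * q ^ (n + 2)) q k * qPoch (t * q) q r /
    (qPoch q q k * qPoch (u * c * q) q k * qPoch (u * b * q) q k * qPoch (t * b * c * q) q k *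
      qPoch (u * b * c * q ^ (n + 2)) q k * qPoch q q r)) *
      ((1 - u * b * c * (q ^ (k + 1)) ^ 2) * q ^ (k + 1) *
        (1 - u * b * c * t * q ^ (k + 1) * q ^ (n + 1)) * (1 - t * q ^ (r + 1)) /
          ((1 - q ^ (k + 1)) * (1 - u * c * q ^ (k + 1)) * (1 - u * b * q ^ (k + 1)) *
            (1 - t * b * c * q ^ (k + 1)) *
            (1 - u * b * c * q ^ (k + 1) * q ^ (n + 1)) * (1 - q ^ (r + 1)))) := by
    rw [jacksonTerm, qPoch_succ (t * q), qPoch_succ q, qPoch_succ q, qPoch_succ (u * c * q),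
      qPoch_succ (u * b * q), qPoch_succ (t * b * c * q), vwp_succ,
      qPoch_succ (u * b * c * t * q ^ (n + 1 + 1)), qPoch_succ (u * b * c * q ^ (n + 1 + 1))]
    simp only [div_eq_mul_inv, mul_inv]
    rw [show t * q * q ^ r = t * q ^ (r + 1) by ring, show q * q ^ r = q ^ (r + 1) by ring,
      show q * q ^ k = q ^ (k + 1) by ring, show u * c * q * q ^ k = u * c * q ^ (k + 1) by ring,
      show u * b * q * q ^ k = u * b * q ^ (k + 1) by ring,
      show t * b * c * q * q ^ k = t * b * c * q ^ (k + 1) by ring,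
      show u * b * c * q ^ (n + 1 + 1) * q ^ k = u * b * c * q ^ (k + 1) * q ^ (n + 1) by ring]
    ring
  have e3 : jacksonTerm b c u t q n (k + 1) r =
      (qPoch (u * b * c * q) q k * qPoch b q (k + 1) * qPoch c q (k + 1) * qDiff t u q (k + 1) *
      qPoch (u * b * c * t * q ^ (n + 2)) q k * qPoch (t * q) q r /
    (qPoch q q k * qPoch (u * c * q) q k * qPoch (u * b * q) q k * qPoch (t * b * c * q) q k *
      qPoch (u * b * c * q ^ (n + 2)) q k * qPoch q q r)) *
      ((1 - u * b * c * (q ^ (k + 1)) ^ 2) * q ^ (k + 1) *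
        (1 - u * b * c * t * q ^ (n + 1)) /
          ((1 - q ^ (k + 1)) * (1 - u * c * q ^ (k + 1)) * (1 - u * b * q ^ (k + 1)) *
            (1 - t * b * c * q ^ (k + 1)) * (1 - u * b * c * q ^ (n + 1)))) := by
    rw [jacksonTerm, qPoch_succ q, qPoch_succ (u * c * q),
      qPoch_succ (u * b * q), qPoch_succ (t * b * c * q), vwp_succ,
      qPoch_succ_left (u * b * c * t * q ^ (n + 1)), qPoch_succ_left (u * b * c * q ^ (n + 1))]
    simp only [div_eq_mul_inv, mul_inv]
    rw [show q * q ^ k = q ^ (k + 1) by ring, show u * c * q * q ^ k = u * c * q ^ (k + 1) by ring,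
      show u * b * q * q ^ k = u * b * q ^ (k + 1) by ring,
      show t * b * c * q * q ^ k = t * b * c * q ^ (k + 1) by ring,
      show u * b * c * q ^ (n + 1) * q = u * b * c * q ^ (n + 2) by ring,
      show u * b * c * t * q ^ (n + 1) * q = u * b * c * t * q ^ (n + 2) by ring]
    ring
  have e4 : jacksonAnti b c u t q n (k + 1) r =
      -(q ^ (n + 1)) * (1 - u * b * c * t * (q ^ (n + 1)) ^ 2) *
      ((qPoch (u * b * c * q) q k * qPoch b q (k + 1) * qPoch c q (k + 1) * qDiff t u q (k + 1) *
      qPoch (u * b * c * t * q ^ (n + 2)) q k * qPoch (t * q) q r /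
    (qPoch q q k * qPoch (u * c * q) q k * qPoch (u * b * q) q k * qPoch (t * b * c * q) q k *
      qPoch (u * b * c * q ^ (n + 2)) q k * qPoch q q r)) *
      ((1 - u * b * c * q ^ (k + 1)) * (1 - b * q ^ (k + 1)) * (1 - c * q ^ (k + 1)) *
        (t - u * q ^ (k + 1)) * (1 - u * b * c * t * q ^ (k + 1) * q ^ (n + 1)) /
          ((1 - q ^ (k + 1)) * (1 - u * c * q ^ (k + 1)) * (1 - u * b * q ^ (k + 1)) *
            (1 - t * b * c * q ^ (k + 1)) *
            (1 - u * b * c * q ^ (k + 1) * q ^ (n + 1))))) := by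
    rw [jacksonAnti, qPoch_succ q, qPoch_succ (u * c * q), qPoch_succ b q (k + 1),
      qPoch_succ c q (k + 1), qDiff_succ t u q (k + 1), qPoch_succ (u * b * c * q),
      qPoch_succ (u * b * q), qPoch_succ (t * b * c * q),
      qPoch_succ (u * b * c * t * q ^ (n + 2)), qPoch_succ (u * b * c * q ^ (n + 2))]
    simp only [div_eq_mul_inv, mul_inv]
    rw [show q * q ^ k = q ^ (k + 1) by ring, show u * c * q * q ^ k = u * c * q ^ (k + 1) by ring,
      show u * b * q * q ^ k = u * b * q ^ (k + 1) by ring,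
      show t * b * c * q * q ^ k = t * b * c * q ^ (k + 1) by ring,
      show u * b * c * q ^ (n + 2) * q ^ k = u * b * c * q ^ (k + 1) * q ^ (n + 1) by ring]
    ring
  rw [e1, e2, e3, e4]
  generalize (qPoch (u * b * c * q) q k * qPoch b q (k + 1) * qPoch c q (k + 1) *
      qDiff t u q (k + 1) * qPoch (u * b * c * t * q ^ (n + 2)) q k * qPoch (t * q) q r /
    (qPoch q q k * qPoch (u * c * q) q k * qPoch (u * b * q) q k * qPoch (t * b * c * q) q k *
      qPoch (u * b * c * q ^ (n + 2)) q k * qPoch q q r)) = G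
  have h5 : 1 - u * b * c * q ^ (k + 1) * q ^ (n + 1) ≠ 0 := by
    have := ne ha (k + 1 + n)
    rwa [show k + 1 + n + 1 = k + 1 + (n + 1) by ring, pow_add, ← mul_assoc] at this
  have h7 := ne ha n
  rw [hy] at h5 h7 ⊢
  exact jackson_rational_identity b c u t _ _ G (ne1 k) (ne hc k) (ne hb k) (ne hbc k) h5
    (ne1 r) h7

/-- The combination of the summands for `n + 1` and `n` is a difference in `k`, so its partial sums
collapse. The range stops at `k ≤ n`, where both summands make sense. -/
theorem sum_jacksonTerm_sub (hq : ∀ n : ℕ, q * q ^ n ≠ 1) (hc : ∀ n : ℕ, u * c * q * q ^ n ≠ 1)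
    (hb : ∀ n : ℕ, u * b * q * q ^ n ≠ 1) (hbc : ∀ n : ℕ, t * b * c * q * q ^ n ≠ 1)
    (ha : ∀ n : ℕ, u * b * c * q * q ^ n ≠ 1) (n k : ℕ) (hk : k ≤ n) :
    ∑ i ∈ Finset.range (k + 1),
      ((1 - q ^ (n + 1)) * (1 - u * c * q ^ (n + 1)) * (1 - u * b * q ^ (n + 1)) *
          (1 - t * b * c * q ^ (n + 1)) * jacksonTerm b c u t q (n + 1) i (n + 1 - i) -
        (1 - u * b * c * q ^ (n + 1)) * (1 - u * q ^ (n + 1)) * (1 - t * c * q ^ (n + 1)) *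
          (1 - t * b * q ^ (n + 1)) * jacksonTerm b c u t q n i (n - i)) =
    jacksonAnti b c u t q n k (n - k) := by
  induction k with
  | zero =>
    have hq1 : 1 - q ^ (n + 1) ≠ 0 := by
      have := sub_ne_zero.2 (hq n).symm
      rwa [pow_succ']
    have hqn := qPoch_ne_zero hq n
    simp only [zero_add, Finset.sum_range_one, Nat.sub_zero, jacksonTerm, jacksonAnti, vwp_zero,
      qPoch_zero, qDiff_zero, pow_zero, qPoch_succ, qDiff_succ, one_mul, mul_one]
    rw [show q * q ^ n = q ^ (n + 1) by ring]
    field_simp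
    ring
  | succ k ih =>
    obtain ⟨r, rfl⟩ : ∃ r, n = k + 1 + r := ⟨n - (k + 1), by omega⟩
    rw [Finset.sum_range_succ, ih (by omega)]
    have := jacksonAnti_step hq hc hb hbc ha (k + 1 + r) k r rfl
    have e1 : k + 1 + r - k = r + 1 := by omega
    have e2 : k + 1 + r + 1 - (k + 1) = r + 1 := by omega
    have e3 : k + 1 + r - (k + 1) = r := by omega
    rw [e1, e2, e3]
    exact this

/-- The sum for `n + 1` has one more term, `k = n + 1`, than the telescoped range; that term cancels
the boundary value. -/
theorem jacksonAnti_self (hq : ∀ n : ℕ, q * q ^ n ≠ 1) (hc : ∀ n : ℕ, u * c * q * q ^ n ≠ 1)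
    (hb : ∀ n : ℕ, u * b * q * q ^ n ≠ 1) (hbc : ∀ n : ℕ, t * b * c * q * q ^ n ≠ 1)
    (ha : ∀ n : ℕ, u * b * c * q * q ^ n ≠ 1) (n : ℕ) :
    jacksonAnti b c u t q n n 0 + (1 - q ^ (n + 1)) * (1 - u * c * q ^ (n + 1)) *
      (1 - u * b * q ^ (n + 1)) * (1 - t * b * c * q ^ (n + 1)) *
      jacksonTerm b c u t q (n + 1) (n + 1) 0 = 0 := by
  have ne : ∀ {x : ℂ}, (∀ n : ℕ, x * q * q ^ n ≠ 1) → ∀ m : ℕ, 1 - x * q ^ (m + 1) ≠ 0 := by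
    intro x hx m
    have := sub_ne_zero.2 (hx m).symm
    rwa [pow_succ', ← mul_assoc]
  have h1 : 1 - q ^ (n + 1) ≠ 0 := by
    have := ne (x := 1) (by simpa using hq) n
    simpa using this
  have h2 := ne hc n
  have h3 := ne hb n
  have h4 := ne hbc n
  have h5 : 1 - u * b * c * (q ^ (n + 1)) ^ 2 ≠ 0 := by
    have := ne ha (2 * n + 1)
    rwa [show 2 * n + 1 + 1 = (n + 1) * 2 by ring, pow_mul] at this
  have p1 := qPoch_ne_zero hq n
  have p2 := qPoch_ne_zero hc n
  have p3 := qPoch_ne_zero hb n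
  have p4 := qPoch_ne_zero hbc n
  have p5 : qPoch (u * b * c * q ^ (n + 2)) q n ≠ 0 := qPoch_ne_zero (fun m => by
    have := ha (n + 1 + m)
    rwa [show u * b * c * q * q ^ (n + 1 + m) = u * b * c * q ^ (n + 2) * q ^ m by ring] at this) n
  rw [jacksonAnti, jacksonTerm, vwp_succ, qPoch_succ q, qPoch_succ (u * c * q),
      qPoch_succ (u * b * q), qPoch_succ (t * b * c * q),
      qPoch_succ (u * b * c * t * q ^ (n + 1 + 1)), qPoch_succ (u * b * c * q ^ (n + 1 + 1))]
  rw [show q * q ^ n = q ^ (n + 1) by ring, show u * c * q * q ^ n = u * c * q ^ (n + 1) by ring,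
      show u * b * q * q ^ n = u * b * q ^ (n + 1) by ring,
      show t * b * c * q * q ^ n = t * b * c * q ^ (n + 1) by ring,
      show u * b * c * q ^ (n + 1 + 1) * q ^ n = u * b * c * (q ^ (n + 1)) ^ 2 by ring,
      show u * b * c * q ^ (2 * n + 2) = u * b * c * (q ^ (n + 1)) ^ 2 by ring,
      show u * b * c * t * q ^ (n + 1 + 1) * q ^ n = u * b * c * t * (q ^ (n + 1)) ^ 2 by ring,
      show n + 1 + 1 = n + 2 by rfl]
  generalize q ^ (n + 1) = y at *
  generalize 1 - y = d1 at *
  generalize 1 - u * c * y = d2 at *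
  generalize 1 - u * b * y = d3 at *
  generalize 1 - t * b * c * y = d4 at *
  generalize 1 - u * b * c * y ^ 2 = d5 at *
  generalize qPoch q q n = Q1 at *
  generalize qPoch (u * c * q) q n = Q2 at *
  generalize qPoch (u * b * q) q n = Q3 at *
  generalize qPoch (t * b * c * q) q n = Q4 at *
  generalize qPoch (u * b * c * q ^ (n + 2)) q n = Q5 at *
  generalize qPoch (u * b * c * t * q ^ (n + 2)) q n = Q6 at *
  generalize 1 - u * b * c * t * y ^ 2 = d6 at *
  simp only [qPoch_zero]
  field_simp
  ring

/-- Jackson's sum (`t ≠ 0`) and the terminating very-well-poised `₆φ₅` sum (`t = 0`). -/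
theorem sum_jacksonTerm_of_ne (hq : ∀ n : ℕ, q * q ^ n ≠ 1)
    (hc : ∀ n : ℕ, u * c * q * q ^ n ≠ 1)
    (hb : ∀ n : ℕ, u * b * q * q ^ n ≠ 1) (hbc : ∀ n : ℕ, t * b * c * q * q ^ n ≠ 1)
    (ha : ∀ n : ℕ, u * b * c * q * q ^ n ≠ 1) (n : ℕ) :
    ∑ k ∈ Finset.range (n + 1), jacksonTerm b c u t q n k (n - k) =
      qPoch (u * b * c * q) q n * qPoch (u * q) q n * qPoch (t * c * q) q n *
          qPoch (t * b * q) q n /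
        (qPoch q q n * qPoch (u * c * q) q n * qPoch (u * b * q) q n *
          qPoch (t * b * c * q) q n) := by
  induction n with
  | zero => simp [jacksonTerm]
  | succ n ih =>
    have h := sum_jacksonTerm_sub hq hc hb hbc ha n n le_rfl
    have h0 := jacksonAnti_self hq hc hb hbc ha n
    rw [Finset.sum_sub_distrib, ← Finset.mul_sum, ← Finset.mul_sum, ih, Nat.sub_self] at h
    rw [Finset.sum_range_succ, Nat.sub_self]
    have ne : ∀ {x : ℂ}, (∀ n : ℕ, x * q * q ^ n ≠ 1) → 1 - x * q ^ (n + 1) ≠ 0 := by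
      intro x hx
      have := sub_ne_zero.2 (hx n).symm
      rwa [pow_succ', ← mul_assoc]
    have h1 : 1 - q ^ (n + 1) ≠ 0 := by
      have := ne (x := 1) (by simpa using hq)
      simpa using this
    have h2 := ne hc
    have h3 := ne hb
    have h4 := ne hbc
    have p1 := qPoch_ne_zero hq n
    have p2 := qPoch_ne_zero hc n
    have p3 := qPoch_ne_zero hb n
    have p4 := qPoch_ne_zero hbc n
    simp only [qPoch_succ]
    have e : ∀ x : ℂ, x * q * q ^ n = x * q ^ (n + 1) := fun x => by ring
    simp only [e, show q * q ^ n = q ^ (n + 1) by ring]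
    generalize ∑ x ∈ Finset.range (n + 1), jacksonTerm b c u t q (n + 1) x (n + 1 - x) = S at *
    generalize jacksonTerm b c u t q (n + 1) (n + 1) 0 = T at *
    -- The first-order recurrence in `n` for the sum; the product side visibly obeys the same one.
    have h' : (1 - q ^ (n + 1)) * (1 - u * c * q ^ (n + 1)) * (1 - u * b * q ^ (n + 1)) *
        (1 - t * b * c * q ^ (n + 1)) * (S + T) =
        (1 - u * b * c * q ^ (n + 1)) * (1 - u * q ^ (n + 1)) * (1 - t * c * q ^ (n + 1)) *
          (1 - t * b * q ^ (n + 1)) *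
        (qPoch (u * b * c * q) q n * qPoch (u * q) q n * qPoch (t * c * q) q n *
          qPoch (t * b * q) q n /
        (qPoch q q n * qPoch (u * c * q) q n * qPoch (u * b * q) q n *
          qPoch (t * b * c * q) q n)) := by
      linear_combination h + h0
    rw [← mul_right_inj' (mul_ne_zero (mul_ne_zero (mul_ne_zero h1 h2) h3) h4), h']
    generalize 1 - t * b * c * q ^ (n + 1) = d4 at *
    generalize qPoch (t * b * c * q) q n = Q4 at *
    field_simp

end Jackson

/-! ### Continuity in a parameter, and countability of the exceptional values. -/

section Continuity

@[fun_prop] theorem Continuous.qPoch {f : ℂ → ℂ} (hf : Continuous f) (q : ℂ) (n : ℕ) :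
    Continuous fun v => qPoch (f v) q n := by
  unfold _root_.qPoch
  fun_prop

@[fun_prop] theorem Continuous.qDiff {f g : ℂ → ℂ} (hf : Continuous f) (hg : Continuous g)
    (q : ℂ) (n : ℕ) : Continuous fun v => qDiff (f v) (g v) q n := by
  unfold _root_.qDiff
  fun_prop

@[fun_prop] theorem Continuous.vwp {f : ℂ → ℂ} (hf : Continuous f) (q : ℂ) (n : ℕ) :
    Continuous fun v => vwp (f v) q n := by
  cases n with
  | zero => exact continuous_const
  | succ n => simp only [vwp_succ]; fun_prop

end Continuity

theorem countable_setOf_mul_pow_eq_one (x q : ℂ) :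
    {v : ℂ | ∃ m : ℕ, v * x * q ^ m = 1}.Countable := by
  have : {v : ℂ | ∃ m : ℕ, v * x * q ^ m = 1} = ⋃ m : ℕ, {v : ℂ | v * x * q ^ m = 1} := by
    ext; simp
  rw [this]
  refine Set.countable_iUnion fun m => Set.Subsingleton.countable ?_
  intro v hv w hw
  have hv' : v * x * q ^ m = 1 := hv
  have hw' : w * x * q ^ m = 1 := hw
  have h0 : x * q ^ m ≠ 0 := by
    intro h
    rw [mul_assoc, h, mul_zero] at hv'
    exact zero_ne_one hv'
  exact mul_right_cancel₀ h0 (by rw [← mul_assoc, ← mul_assoc, hv', hw'])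

/-! ### Jackson's sum under weaker hypotheses, and the ₆φ₅ sum. -/

section Terminating

variable {q : ℂ}

/-- Jackson's sum (`t ≠ 0`) and the terminating very-well-poised `₆φ₅` sum (`t = 0`). -/
theorem sum_jacksonTerm {b c u t : ℂ} (hq : ∀ n : ℕ, q * q ^ n ≠ 1)
    (hc : ∀ n : ℕ, u * c * q * q ^ n ≠ 1)
    (hb : ∀ n : ℕ, u * b * q * q ^ n ≠ 1) (hbc : ∀ n : ℕ, t * b * c * q * q ^ n ≠ 1) (n : ℕ)
    (ha : ∀ m : ℕ, u * b * c * q ^ (n + 1) * q ^ m ≠ 1) :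
    ∑ k ∈ Finset.range (n + 1), jacksonTerm b c u t q n k (n - k) =
      qPoch (u * b * c * q) q n * qPoch (u * q) q n * qPoch (t * c * q) q n *
          qPoch (t * b * q) q n /
        (qPoch q q n * qPoch (u * c * q) q n * qPoch (u * b * q) q n *
          qPoch (t * b * c * q) q n) := by
  -- The telescoping needs `u b c q^{m+1} ≠ 1` for all `m`, but the summands only have `(u b c
  -- q^{n+1}; q)_k` in the denominator. Values of `u` satisfying the stronger condition are dense,
  -- and both sides are continuous at the given `u`. The gain matters when `a q` is itself a
  -- terminating parameter.
  have hbad := ((countable_setOf_mul_pow_eq_one (c * q) q).union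
    (countable_setOf_mul_pow_eq_one (b * q) q)).union
      (countable_setOf_mul_pow_eq_one (b * c * q) q)
  have hdense := hbad.dense_compl ℂ u
  have hfreq := mem_closure_iff_frequently.1 hdense
  have hL : ContinuousAt
      (fun v => ∑ k ∈ Finset.range (n + 1), jacksonTerm b c v t q n k (n - k)) u := by
    refine tendsto_finsetSum _ fun k _ => ?_
    unfold jacksonTerm
    refine ContinuousAt.div (Continuous.continuousAt (by fun_prop))
      (Continuous.continuousAt (by fun_prop)) ?_
    have p1 := qPoch_ne_zero hq k
    have p2 := qPoch_ne_zero hc k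
    have p3 := qPoch_ne_zero hb k
    have p4 := qPoch_ne_zero hbc k
    have p5 := qPoch_ne_zero ha k
    have p6 := qPoch_ne_zero hq (n - k)
    simp only [ne_eq, mul_eq_zero, not_or]
    exact ⟨⟨⟨⟨⟨p1, p2⟩, p3⟩, p4⟩, p5⟩, p6⟩
  have hR : ContinuousAt (fun v => qPoch (v * b * c * q) q n * qPoch (v * q) q n *
      qPoch (t * c * q) q n * qPoch (t * b * q) q n /
        (qPoch q q n * qPoch (v * c * q) q n * qPoch (v * b * q) q n *
          qPoch (t * b * c * q) q n)) u := by
    refine ContinuousAt.div (Continuous.continuousAt (by fun_prop))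
      (Continuous.continuousAt (by fun_prop)) ?_
    have p1 := qPoch_ne_zero hq n
    have p2 := qPoch_ne_zero hc n
    have p3 := qPoch_ne_zero hb n
    have p4 := qPoch_ne_zero hbc n
    simp only [ne_eq, mul_eq_zero, not_or]
    exact ⟨⟨⟨p1, p2⟩, p3⟩, p4⟩
  refine tendsto_nhds_unique_of_frequently_eq hL hR (hfreq.mono fun v hv => ?_)
  simp only [Set.compl_union, Set.mem_inter_iff, Set.mem_compl_iff, Set.mem_ofPred_eq,
    not_exists] at hv
  obtain ⟨⟨h1, h2⟩, h3⟩ := hv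
  refine sum_jacksonTerm_of_ne hq (fun m => ?_) (fun m => ?_) hbc (fun m => ?_) n
  · simpa only [mul_assoc] using h1 m
  · simpa only [mul_assoc] using h2 m
  · simpa only [mul_assoc] using h3 m

/-- It trades the factor `1 / (q; q)_{m-k}` of Jackson's summand for the terminating parameter `q ^
(-m)` in homogeneous form. -/
theorem qDiff_pow_mul_qPoch (m k : ℕ) (hk : k ≤ m) :
    qDiff (q ^ m) 1 q k * qPoch q q (m - k) = qPoch q q m * qDiff 0 1 q k := by
  induction k with
  | zero => simp
  | succ k ih =>
    obtain ⟨r, rfl⟩ : ∃ r, m = k + 1 + r := ⟨m - (k + 1), by omega⟩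
    have h := ih (by omega)
    rw [show k + 1 + r - k = r + 1 by omega, qPoch_succ] at h
    rw [show k + 1 + r - (k + 1) = r by omega, qDiff_succ, qDiff_succ]
    have e : q ^ (k + 1 + r) - 1 * q ^ k = -q ^ k * (1 - q * q ^ r) := by ring
    rw [e]
    linear_combination (-q ^ k) * h

theorem qDiff_zero_left (u : ℂ) (k : ℕ) : qDiff 0 u q k = u ^ k * qDiff 0 1 q k := by
  rw [← qDiff_mul]
  simp

/-- The terminating very-well-poised `₆φ₅` sum. -/
theorem sum_six_phi_five {α β ε : ℂ} (hβ : β ≠ 0) (hε : ε ≠ 0) (hq : ∀ n : ℕ, q * q ^ n ≠ 1)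
    (h1 : ∀ n : ℕ, α * q / β * q ^ n ≠ 1) (h2 : ∀ n : ℕ, α * q / ε * q ^ n ≠ 1) (m : ℕ)
    (h3 : ∀ n : ℕ, α * q ^ (m + 1) * q ^ n ≠ 1) :
    ∑ i ∈ Finset.range (m + 1), vwp α q i * qPoch β q i * qPoch ε q i *
        (α * q / (β * ε)) ^ i * qDiff (q ^ m) 1 q i /
        (qPoch q q i * qPoch (α * q / β) q i * qPoch (α * q / ε) q i *
          qPoch (α * q ^ (m + 1)) q i) =
      qPoch (α * q) q m * qPoch (α * q / (β * ε)) q m /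
        (qPoch (α * q / β) q m * qPoch (α * q / ε) q m) := by
  have e1 : α / (β * ε) * ε * q = α * q / β := by field_simp
  have e2 : α / (β * ε) * β * q = α * q / ε := by field_simp
  have e3 : α / (β * ε) * β * ε = α := by field_simp
  have e4 : α / (β * ε) * q = α * q / (β * ε) := by field_simp
  -- `u` is chosen to make the base `u b c` equal to `α`. Setting `t = 0` sends the parameter `u /
  -- t` to infinity, and the factorials with `t` in their argument become `1`.
  have h := sum_jacksonTerm (b := β) (c := ε) (u := α / (β * ε)) (t := 0) hq
    (by rwa [e1]) (by rwa [e2]) (by simp) m (by rwa [e3])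
  simp only [jacksonTerm, e1, e2, e3, e4, zero_mul, mul_zero] at h
  have z0 : ∀ k, qPoch 0 q k = 1 := fun k => by simp [qPoch]
  simp only [z0, mul_one] at h
  have hm := qPoch_ne_zero hq m
  calc _ = qPoch q q m * ∑ i ∈ Finset.range (m + 1), vwp α q i * qPoch β q i * qPoch ε q i *
        qDiff 0 (α / (β * ε)) q i * q ^ i /
        (qPoch q q i * qPoch (α * q / β) q i * qPoch (α * q / ε) q i *
          qPoch (α * q ^ (m + 1)) q i * qPoch q q (m - i)) := by
        rw [Finset.mul_sum]
        refine Finset.sum_congr rfl fun i hi => ?_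
        have hmi := qPoch_ne_zero hq (m - i)
        have key := qDiff_pow_mul_qPoch (q := q) m i
          (Nat.lt_succ_iff.1 (Finset.mem_range.1 hi))
        rw [← eq_div_iff hmi] at key
        rw [key, qDiff_zero_left (α / (β * ε)), ← e4, mul_pow]
        simp only [div_eq_mul_inv, mul_inv]
        ring
    _ = _ := by
        rw [h]
        generalize qPoch (α * q / β) q m = d1
        generalize qPoch (α * q / ε) q m = d2
        rw [mul_assoc (qPoch q q m), mul_div_assoc', mul_div_mul_left _ _ hm]

end Terminating

/-! ### The terminating ₈φ₇ transformation. -/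

/-- The part of the `k`-th term of a very-well-poised series that involves four of the
parameters. -/
noncomputable def poisedTerm (a b c d e q z : ℂ) (k : ℕ) : ℂ :=
  vwp a q k * qPoch b q k * qPoch c q k * qPoch d q k * qPoch e q k * z ^ k /
    (qPoch q q k * qPoch (a * q / b) q k * qPoch (a * q / c) q k * qPoch (a * q / d) q k *
      qPoch (a * q / e) q k)

section Terminating

variable {q a b c d e lam : ℂ}

/-- Jackson's sum with base `lam` and parameters `lam b / a, lam c / a, lam d / a`, read from right
to left. The choices `u = d / q`, `t = a / (lam q)` give this base because `lam b c d = q a²`. In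
the summand, `k` enters only through factors that combine well with the very-well-poised part of
base `a`. -/
theorem sum_jackson_expansion (hq0 : q ≠ 0) (hq : ∀ n : ℕ, q * q ^ n ≠ 1) (ha : a ≠ 0)
    (hb : b ≠ 0) (hc : c ≠ 0)
    (hd : d ≠ 0) (hlam : lam * (b * c * d) = q * a ^ 2)
    (h1 : ∀ n : ℕ, a * q / b * q ^ n ≠ 1) (h2 : ∀ n : ℕ, a * q / c * q ^ n ≠ 1)
    (h3 : ∀ n : ℕ, a * q / d * q ^ n ≠ 1) (h4 : ∀ n : ℕ, lam * q * q ^ n ≠ 1) (k : ℕ) :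
    ∑ j ∈ Finset.range (k + 1), vwp lam q j * qPoch (lam * b / a) q j * qPoch (lam * c / a) q j *
        qPoch (lam * d / a) q j * (a / lam) ^ j * qPoch (a * q ^ k) q j *
        qPoch (a / lam) q (k - j) /
      (qPoch q q j * qPoch (a * q / b) q j * qPoch (a * q / c) q j * qPoch (a * q / d) q j *
        qPoch (lam * q * q ^ k) q j * qPoch q q (k - j)) =
    qPoch (lam * q) q k * qPoch b q k * qPoch c q k * qPoch d q k /
      (qPoch q q k * qPoch (a * q / b) q k * qPoch (a * q / c) q k * qPoch (a * q / d) q k) := by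
  have hl : lam = q * a ^ 2 / (b * c * d) := by field_simp; linear_combination hlam
  have hl0 : lam ≠ 0 := by rw [hl]; positivity
  have e1 : d / q * (lam * c / a) * q = a * q / b := by rw [hl]; field_simp
  have e2 : d / q * (lam * b / a) * q = a * q / c := by rw [hl]; field_simp
  have e3 : a / (lam * q) * (lam * b / a) * (lam * c / a) * q = a * q / d := by
    rw [hl]; field_simp
  have e4 : d / q * (lam * b / a) * (lam * c / a) = lam := by
    nth_rewrite 1 [hl]; field_simp
  have e5 : a / (lam * q) * q = a / lam := by field_simp
  have e6 : a / (lam * q) * (lam * c / a) * q = c := by field_simp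
  have e7 : a / (lam * q) * (lam * b / a) * q = b := by field_simp
  have e8 : d / q * q = d := by field_simp
  have e9 : lam * (a / (lam * q)) * q ^ (k + 1) = a * q ^ k := by field_simp; ring
  have e10 : lam * q ^ (k + 1) = lam * q * q ^ k := by ring
  have h := sum_jacksonTerm (b := lam * b / a) (c := lam * c / a) (u := d / q)
    (t := a / (lam * q)) hq (by rwa [e1]) (by rwa [e2]) (by rwa [e3]) k (by
      rw [e4]
      intro m hm
      exact h4 (k + m) (by rw [← hm]; ring))
  simp only [jacksonTerm, e1, e2, e3, e4, e5, e6, e7, e8, e9, e10] at h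
  refine Eq.trans (Finset.sum_congr rfl fun j _ => ?_) (h.trans ?_)
  · have e11 : qDiff (a / (lam * q)) (d / q) q j
        = (a / (lam * q)) ^ j * qPoch (lam * d / a) q j := by
      rw [← qDiff_one, ← qDiff_mul]
      congr 1
      · ring
      · field_simp
    rw [e11, ← e5, mul_pow]
    simp only [div_eq_mul_inv, mul_inv]
    ring
  · simp only [div_eq_mul_inv, mul_inv]
    ring

theorem qDiff_pow_scale (n j i : ℕ) (hj : j ≤ n) :
    qDiff (q ^ n) (1 * q ^ j) q i = (q ^ j) ^ i * qDiff (q ^ (n - j)) 1 q i := by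
  rw [← qDiff_mul]
  congr 1
  · rw [← pow_add]; congr 1; omega
  · ring

/-- With `k = j + i`, the sum over `i` is a ₆φ₅ with base `a q^{2j}` and parameters `a / lam`, `e
q^j`, `q^{-(n-j)}`. Its value splits into a factor free of `j` and the `j`-dependent part of the
transformed series. -/
theorem sum_poised_inner (hq0 : q ≠ 0) (hq : ∀ n : ℕ, q * q ^ n ≠ 1) (ha : a ≠ 0) (hl0 : lam ≠ 0)
    (he : e ≠ 0) (h4 : ∀ n : ℕ, lam * q * q ^ n ≠ 1) (h5 : ∀ n : ℕ, a * q / e * q ^ n ≠ 1)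
    (h6 : ∀ n : ℕ, lam * q / e * q ^ n ≠ 1) (n : ℕ) (h7 : ∀ m : ℕ, a * q * q ^ n * q ^ m ≠ 1)
    (j : ℕ) (hj : j ≤ n) :
    ∑ i ∈ Finset.range (n - j + 1), vwp a q (j + i) * qPoch (a * q ^ (j + i)) q j *
      qPoch (a / lam) q i * qPoch e q (j + i) * (lam * q / e) ^ (j + i) *
      qDiff (q ^ n) 1 q (j + i) /
      (qPoch q q i * qPoch (a * q / e) q (j + i) * qPoch (a * q * q ^ n) q (j + i) *
        (qPoch (lam * q) q (j + i) * qPoch (lam * q * q ^ (j + i)) q j)) =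
    qPoch (a * q) q n * qPoch (lam * q / e) q n /
      (qPoch (lam * q) q n * qPoch (a * q / e) q n) *
      (qPoch e q j * (lam * q / e) ^ j * qDiff (q ^ n) 1 q j /
        (qPoch (lam * q / e) q j * qPoch (lam * q * q ^ n) q j)) := by
  have e1 : a * q ^ (2 * j) * q / (a / lam) = lam * q * q ^ (2 * j) := by field_simp
  have e2 : a * q ^ (2 * j) * q / (e * q ^ j) = a * q / e * q ^ j := by
    field_simp; ring
  have e3 : a * q ^ (2 * j) * q / (a / lam * (e * q ^ j)) = lam * q / e * q ^ j := by
    field_simp; ring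
  have e4 : a * q ^ (2 * j) * q ^ (n - j + 1) = a * q * q ^ n * q ^ j := by
    obtain ⟨m, rfl⟩ := Nat.exists_eq_add_of_le hj
    rw [Nat.add_sub_cancel_left]; ring
  have e5 : a * q ^ (2 * j) * q = a * q * q ^ (2 * j) := by ring
  have six := sum_six_phi_five (α := a * q ^ (2 * j)) (β := a / lam) (ε := e * q ^ j)
    (div_ne_zero ha hl0) (mul_ne_zero he (pow_ne_zero _ hq0)) hq
    (by intro m hm; rw [e1] at hm; exact h4 (2 * j + m) (by rw [← hm]; ring))
    (by intro m hm; rw [e2] at hm; exact h5 (j + m) (by rw [← hm]; ring)) (n - j)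
    (by intro m hm; rw [e4] at hm; exact h7 (j + m) (by rw [← hm]; ring))
  rw [e1, e2, e3, e4, e5] at six
  calc _ = qPoch (a * q) q (2 * j) / qPoch (lam * q) q (2 * j) *
        (qPoch e q j * (lam * q / e) ^ j * qDiff (q ^ n) 1 q j /
          (qPoch (a * q / e) q j * qPoch (a * q * q ^ n) q j)) *
        ∑ i ∈ Finset.range (n - j + 1), vwp (a * q ^ (2 * j)) q i * qPoch (a / lam) q i *
          qPoch (e * q ^ j) q i * (lam * q / e * q ^ j) ^ i * qDiff (q ^ (n - j)) 1 q i /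
          (qPoch q q i * qPoch (lam * q * q ^ (2 * j)) q i * qPoch (a * q / e * q ^ j) q i *
            qPoch (a * q * q ^ n * q ^ j) q i) := by
        rw [Finset.mul_sum]
        refine Finset.sum_congr rfl fun i _ => ?_
        rw [← qPoch_add, vwp_add_mul_qPoch, qPoch_add e, qPoch_add (a * q / e),
          qPoch_add (a * q * q ^ n), qDiff_add, qDiff_pow_scale n j i hj, add_right_comm, ← two_mul,
          qPoch_add (lam * q)]
        simp only [div_eq_mul_inv, mul_inv, mul_pow, pow_add]
        ring
    _ = _ := by
        rw [six]
        -- Both sides are `(aq; q)_{n+j}`; `f2` is the same regrouping with `lam`.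
        have f1 : qPoch (a * q) q (2 * j) * qPoch (a * q * q ^ (2 * j)) q (n - j)
            = qPoch (a * q) q n * qPoch (a * q * q ^ n) q j := by
          rw [← qPoch_add, ← qPoch_add]; congr 1; omega
        have f2 : qPoch (lam * q) q (2 * j) * qPoch (lam * q * q ^ (2 * j)) q (n - j)
            = qPoch (lam * q) q n * qPoch (lam * q * q ^ n) q j := by
          rw [← qPoch_add, ← qPoch_add]; congr 1; omega
        have f3 : qPoch (a * q / e) q j * qPoch (a * q / e * q ^ j) q (n - j)
            = qPoch (a * q / e) q n := by
          rw [← qPoch_add]; congr 1; omega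
        have f4 : qPoch (lam * q / e) q j * qPoch (lam * q / e * q ^ j) q (n - j)
            = qPoch (lam * q / e) q n := by
          rw [← qPoch_add]; congr 1; omega
        have p1 := qPoch_ne_zero h7 j
        have p2 := qPoch_ne_zero h6 j
        rw [← f4]
        calc _ = (qPoch (a * q) q (2 * j) * qPoch (a * q * q ^ (2 * j)) q (n - j)) /
              (qPoch (lam * q) q (2 * j) * qPoch (lam * q * q ^ (2 * j)) q (n - j)) /
              (qPoch (a * q / e) q j * qPoch (a * q / e * q ^ j) q (n - j)) *
              qPoch (lam * q / e * q ^ j) q (n - j) *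
              (qPoch e q j * (lam * q / e) ^ j * qDiff (q ^ n) 1 q j) /
              qPoch (a * q * q ^ n) q j := by
              simp only [div_eq_mul_inv, mul_inv]; ring
          _ = _ := by
              rw [f1, f2, f3]
              generalize qPoch (a * q * q ^ n) q j = x1 at *
              generalize qPoch (lam * q / e) q j = x2 at *
              generalize qPoch (lam * q * q ^ n) q j = x3 at *
              generalize qPoch (lam * q) q n = x4 at *
              generalize qPoch (a * q / e) q n = x5 at *
              generalize (lam * q / e) ^ j = x6 at *
              field_simp

/-- The terminating very-well-poised `₈φ₇` transformation. -/
theorem sum_poisedTerm_transformation (hq0 : q ≠ 0) (hq : ∀ n : ℕ, q * q ^ n ≠ 1) (ha : a ≠ 0)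
    (hb : b ≠ 0) (hc : c ≠ 0)
    (hd : d ≠ 0) (he : e ≠ 0) (hlam : lam * (b * c * d) = q * a ^ 2)
    (h1 : ∀ n : ℕ, a * q / b * q ^ n ≠ 1) (h2 : ∀ n : ℕ, a * q / c * q ^ n ≠ 1)
    (h3 : ∀ n : ℕ, a * q / d * q ^ n ≠ 1) (h4 : ∀ n : ℕ, lam * q * q ^ n ≠ 1)
    (h5 : ∀ n : ℕ, a * q / e * q ^ n ≠ 1) (h6 : ∀ n : ℕ, lam * q / e * q ^ n ≠ 1) (n : ℕ)
    (h7 : ∀ m : ℕ, a * q * q ^ n * q ^ m ≠ 1) :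
    ∑ k ∈ Finset.range (n + 1), poisedTerm a b c d e q (lam * q / e) k * qDiff (q ^ n) 1 q k /
        qPoch (a * q * q ^ n) q k =
      qPoch (a * q) q n * qPoch (lam * q / e) q n /
        (qPoch (lam * q) q n * qPoch (a * q / e) q n) *
      ∑ k ∈ Finset.range (n + 1), poisedTerm lam (lam * b / a) (lam * c / a) (lam * d / a) e q
        (a * q / e) k * qDiff (q ^ n) 1 q k / qPoch (lam * q * q ^ n) q k := by
  have hl : lam = q * a ^ 2 / (b * c * d) := by field_simp; linear_combination hlam
  have hl0 : lam ≠ 0 := by rw [hl]; positivity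
  have e1 : lam * q / (lam * b / a) = a * q / b := by field_simp
  have e2 : lam * q / (lam * c / a) = a * q / c := by field_simp
  have e3 : lam * q / (lam * d / a) = a * q / d := by field_simp
  have e4 : a * q / e = lam * q / e * (a / lam) := by field_simp
  set Q : ℕ → ℂ := fun j => vwp lam q j * qPoch (lam * b / a) q j * qPoch (lam * c / a) q j *
        qPoch (lam * d / a) q j * (a / lam) ^ j / (qPoch q q j * qPoch (a * q / b) q j *
          qPoch (a * q / c) q j * qPoch (a * q / d) q j) with hQ
  set f : ℕ → ℕ → ℂ := fun k j => Q j * (vwp a q k * qPoch (a * q ^ k) q j *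
      qPoch (a / lam) q (k - j) * qPoch e q k * (lam * q / e) ^ k *
      qDiff (q ^ n) 1 q k /
      (qPoch q q (k - j) * qPoch (a * q / e) q k * qPoch (a * q * q ^ n) q k *
        (qPoch (lam * q) q k * qPoch (lam * q * q ^ k) q j))) with hf
  calc _ = ∑ k ∈ Finset.range (n + 1), ∑ j ∈ Finset.range (k + 1), f k j := by
        refine Finset.sum_congr rfl fun k _ => ?_
        have hA := sum_jackson_expansion hq0 hq ha hb hc hd hlam h1 h2 h3 h4 k
        have p1 := qPoch_ne_zero h4 k
        -- `(lam q; q)_k` is multiplied and divided in, so that the first factor is the closed form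
        -- in `sum_jackson_expansion`.
        calc _ = (qPoch (lam * q) q k * qPoch b q k * qPoch c q k * qPoch d q k /
              (qPoch q q k * qPoch (a * q / b) q k * qPoch (a * q / c) q k *
                qPoch (a * q / d) q k)) * (vwp a q k * qPoch e q k * (lam * q / e) ^ k *
              qDiff (q ^ n) 1 q k / (qPoch (a * q / e) q k * qPoch (a * q * q ^ n) q k *
                qPoch (lam * q) q k)) := by
              rw [poisedTerm]
              generalize qPoch (lam * q) q k = x1 at *
              simp only [div_eq_mul_inv, mul_inv]
              have : x1 * x1⁻¹ = 1 := mul_inv_cancel₀ p1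
              linear_combination (-1 : ℂ) * (vwp a q k * qPoch b q k * qPoch c q k * qPoch d q k *
                qPoch e q k * (lam * q * e⁻¹) ^ k * qDiff (q ^ n) 1 q k *
                ((qPoch q q k)⁻¹ * (qPoch (a * q * b⁻¹) q k)⁻¹ * (qPoch (a * q * c⁻¹) q k)⁻¹ *
                (qPoch (a * q * d⁻¹) q k)⁻¹ * (qPoch (a * q * e⁻¹) q k)⁻¹ *
                (qPoch (a * q * q ^ n) q k)⁻¹)) * this
          _ = _ := by
              rw [← hA, Finset.sum_mul]
              refine Finset.sum_congr rfl fun j _ => ?_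
              simp only [hf, hQ, div_eq_mul_inv, mul_inv]
              ring
    _ = ∑ j ∈ Finset.range (n + 1), ∑ k ∈ Finset.Ico j (n + 1), f k j := by
        refine Finset.sum_comm' fun k j => ?_
        simp only [Finset.mem_range, Finset.mem_Ico]
        omega
    _ = _ := by
        rw [Finset.mul_sum]
        refine Finset.sum_congr rfl fun j hj => ?_
        have hj' : j ≤ n := Nat.lt_succ_iff.1 (Finset.mem_range.1 hj)
        rw [Finset.sum_Ico_eq_sum_range, show n + 1 - j = n - j + 1 by omega]
        simp only [hf, Nat.add_sub_cancel_left]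
        rw [← Finset.mul_sum, sum_poised_inner hq0 hq ha hl0 he h4 h5 h6 n h7 j hj', poisedTerm, e1, e2,
          e3, hQ, show (a * q / e) ^ j = (lam * q / e) ^ j * (a / lam) ^ j by rw [e4, mul_pow]]
        simp only [div_eq_mul_inv, mul_inv]
        ring

end Terminating

/-! ### Geometric rates for convergent and for terminating series. -/

open Filter Topology in
theorem exists_gt_mul_lt_one {x r s : ℝ} (hr : r * x < 1) (hs : s * x < 1) :
    ∃ U, x < U ∧ r * U < 1 ∧ s * U < 1 := by
  have h1 : ∀ᶠ U in 𝓝 x, r * U < 1 :=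
    (continuous_const.mul continuous_id).continuousAt.eventually_lt_const hr
  have h2 : ∀ᶠ U in 𝓝 x, s * U < 1 :=
    (continuous_const.mul continuous_id).continuousAt.eventually_lt_const hs
  have h3 : ∀ᶠ U in 𝓝[>] x, x < U := self_mem_nhdsWithin
  obtain ⟨U, hU, h⟩ := (h3.and ((h1.and h2).filter_mono nhdsWithin_le_nhds)).exists
  exact ⟨U, hU, h⟩

/-- Finitely supported coefficients decay at any prescribed rate, which lets terminating series be
treated as convergent ones. -/
theorem exists_bound_of_eventually_zero {c : ℕ → ℂ} {N : ℕ} (hc : ∀ k, N ≤ k → c k = 0) {r : ℝ}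
    (hr : 0 < r) : ∃ C : ℝ, 0 ≤ C ∧ ∀ k, ‖c k‖ ≤ C * r ^ k := by
  refine ⟨∑ k ∈ Finset.range N, ‖c k‖ / r ^ k,
    Finset.sum_nonneg fun k _ => by positivity, fun k => ?_⟩
  rcases le_or_gt N k with h | h
  · rw [hc k h, norm_zero]
    exact mul_nonneg (Finset.sum_nonneg fun k _ => by positivity) (by positivity)
  · rw [← div_le_iff₀ (by positivity)]
    exact Finset.single_le_sum (f := fun k => ‖c k‖ / r ^ k) (fun k _ => by positivity)
      (Finset.mem_range.2 h)

/-- Some entry of the list is of the form `q ^ (-m)`. -/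
def HasTerminator (q : ℂ) (l : List ℂ) : Prop := ∃ x ∈ l, ∃ m : ℕ, x * q ^ m = 1

theorem vwp_eq_zero_of_le {a q : ℂ} {m k : ℕ} (h : a * q * q ^ m = 1) (hk : m + 2 ≤ k) :
    vwp a q k = 0 := by
  obtain ⟨l, rfl⟩ : ∃ l, k = l + 1 := ⟨k - 1, by omega⟩
  rw [vwp_succ, qPoch_eq_zero_of_le h (by omega), mul_zero]

section Rates

variable {q : ℂ}

theorem exists_norm_inv_qPoch_le_geom (hq : ‖q‖ < 1) {x : ℂ} (hx : ∀ n : ℕ, x * q ^ n ≠ 1) :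
    ∃ C : ℝ, 0 ≤ C ∧ ∀ k, ‖(qPoch x q k)⁻¹‖ ≤ C * 1 ^ k := by
  simpa using exists_norm_inv_qPoch_le hq hx

theorem mul_pow_ne_one_self (hq : ‖q‖ < 1) (n : ℕ) : q * q ^ n ≠ 1 :=
  mul_pow_ne_one_of_norm_lt hq hq n

theorem geomAnalytic_const_qPoch (hq : ‖q‖ < 1) (x : ℂ) (s : Set ℂ) :
    GeomAnalytic (fun k _ => qPoch x q k) s 1 :=
  geomAnalytic_qPoch hq (differentiableOn_const x) fun _ _ => le_rfl

theorem geomAnalytic_const_qPoch_inv (hq : ‖q‖ < 1) {x : ℂ} (hx : ∀ n : ℕ, x * q ^ n ≠ 1)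
    (s : Set ℂ) : GeomAnalytic (fun k _ => (qPoch x q k)⁻¹) s 1 :=
  .const s (exists_norm_inv_qPoch_le_geom hq hx)

theorem geomAnalytic_const_pow (z : ℂ) (s : Set ℂ) : GeomAnalytic (fun k _ => z ^ k) s ‖z‖ :=
  .const s ⟨1, zero_le_one, fun k => by simp⟩

theorem exists_bound_poisedTerm (hq : ‖q‖ < 1) {a b c d e : ℂ}
    (h1 : ∀ n : ℕ, a * q / b * q ^ n ≠ 1) (h2 : ∀ n : ℕ, a * q / c * q ^ n ≠ 1)
    (h3 : ∀ n : ℕ, a * q / d * q ^ n ≠ 1) (h5 : ∀ n : ℕ, a * q / e * q ^ n ≠ 1) (z : ℂ) :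
    ∃ C : ℝ, 0 ≤ C ∧ ∀ k, ‖poisedTerm a b c d e q z k‖ ≤ C * ‖z‖ ^ k := by
  have hv : GeomAnalytic (fun k _ => vwp a q k) Set.univ 1 :=
    geomAnalytic_vwp hq (differentiableOn_const a) fun _ _ => le_rfl
  have u := fun x => geomAnalytic_const_qPoch hq x Set.univ
  have l := fun {x : ℂ} (hx : ∀ n : ℕ, x * q ^ n ≠ 1) =>
    geomAnalytic_const_qPoch_inv hq hx Set.univ
  have H := (((((hv.mul (u b)).mul (u c)).mul (u d)).mul (u e)).mul
    (geomAnalytic_const_pow z _)).mul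
      (((((l (mul_pow_ne_one_self hq)).mul (l h1)).mul (l h2)).mul (l h3)).mul (l h5))
  obtain ⟨C, hC, hb⟩ := H.bound
  refine ⟨C, hC, fun k => ?_⟩
  have := hb k 0 trivial
  rw [poisedTerm, div_eq_mul_inv]
  simp only [one_mul, mul_one] at this
  simpa only [mul_inv] using this

theorem poisedTerm_eventually_zero {a b c d e : ℂ} (h : HasTerminator q [a * q, b, c, d, e])
    (z : ℂ) : ∃ N, ∀ k, N ≤ k → poisedTerm a b c d e q z k = 0 := by
  obtain ⟨x, hx, m, hm⟩ := h
  -- `vwp` contains `(aq; q)_{k-1}`, so termination through `a * q` comes one index later than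
  -- through the other parameters.
  refine ⟨m + 2, fun k hk => ?_⟩
  simp only [List.mem_cons, List.not_mem_nil, or_false] at hx
  rw [poisedTerm]
  rcases hx with rfl | rfl | rfl | rfl | rfl
  · rw [vwp_eq_zero_of_le hm hk]; simp
  all_goals rw [qPoch_eq_zero_of_le hm (by omega)]; simp

/-- The strict inequality `r * ‖w‖ < 1` leaves room for a disc containing `w` in its interior. In
the terminating case `r` may be chosen after `w`. -/
theorem exists_rate_poisedTerm (hq : ‖q‖ < 1) {a b c d e : ℂ}
    (h1 : ∀ n : ℕ, a * q / b * q ^ n ≠ 1) (h2 : ∀ n : ℕ, a * q / c * q ^ n ≠ 1)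
    (h3 : ∀ n : ℕ, a * q / d * q ^ n ≠ 1) (h5 : ∀ n : ℕ, a * q / e * q ^ n ≠ 1) {z w : ℂ}
    (h : ‖z * w‖ < 1 ∨ HasTerminator q [a * q, b, c, d, e]) :
    ∃ r : ℝ, 0 ≤ r ∧ r * ‖w‖ < 1 ∧
      ∃ C : ℝ, 0 ≤ C ∧ ∀ k, ‖poisedTerm a b c d e q z k‖ ≤ C * r ^ k := by
  rcases h with h | h
  · exact ⟨‖z‖, norm_nonneg _, by rwa [← norm_mul], exists_bound_poisedTerm hq h1 h2 h3 h5 z⟩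
  · obtain ⟨N, hN⟩ := poisedTerm_eventually_zero h z
    have hw : 0 < ‖w‖ + 1 := by positivity
    refine ⟨(‖w‖ + 1)⁻¹, by positivity, ?_, exists_bound_of_eventually_zero hN (by positivity)⟩
    rw [inv_mul_lt_iff₀ hw]
    linarith

end Rates

/-! ### The first transformation by continuation in `1 / f`. -/

section Regularized

variable {q : ℂ}

/-- A series in `w`, multiplied by `(x w; q)_∞` to remove its poles. -/
noncomputable def regularizedSum (x : ℂ) (c : ℕ → ℂ) (q w : ℂ) : ℂ :=
  ∑' k, c k * qDiff w 1 q k * qPochInf (x * w * q ^ k) q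

theorem regularizedSum_eq (hq : ‖q‖ < 1) {x w : ℂ} (c : ℕ → ℂ)
    (h : ∀ n : ℕ, x * w * q ^ n ≠ 1) :
    regularizedSum x c q w
      = qPochInf (x * w) q * ∑' k, c k * qDiff w 1 q k / qPoch (x * w) q k := by
  rw [regularizedSum, ← tsum_mul_left]
  refine tsum_congr fun k => ?_
  rw [← qPoch_mul_qPochInf (x * w) hq k]
  have := qPoch_ne_zero h k
  field_simp

theorem differentiableOn_regularizedSum (hq : ‖q‖ < 1) (x : ℂ) {c : ℕ → ℂ} {r U : ℝ}
    (hr0 : 0 ≤ r) (hU : 0 < U) (hrU : r * U < 1)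
    (hc : ∃ C : ℝ, 0 ≤ C ∧ ∀ k, ‖c k‖ ≤ C * r ^ k) :
    DifferentiableOn ℂ (regularizedSum x c q) (Metric.ball 0 U) := by
  have h : GeomAnalytic (fun k w => c k * qDiff w 1 q k * qPochInf (x * w * q ^ k) q)
      (Metric.ball 0 U) (r * U * 1) := by
    refine ((GeomAnalytic.const _ hc).mul (geomAnalytic_qDiff hq hU differentiableOn_id
      (differentiableOn_const 1) (fun w hw => ?_) (fun _ _ => le_rfl))).mul
      (geomAnalytic_qPochInf hq (V := ‖x‖ * U) (by fun_prop) fun w hw => ?_)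
    · simpa using (mem_ball_zero_iff.1 hw).le
    · rw [norm_mul]
      gcongr
      exact (mem_ball_zero_iff.1 hw).le
  exact h.differentiableOn_tsum Metric.isOpen_ball (by positivity) (by simpa using hrU)

/-- At `w = q ^ n` the factor of index `n` in `qDiff` vanishes, which is termination by `f = q ^
(-n)`. -/
theorem tsum_qDiff_pow (n : ℕ) (g : ℕ → ℂ) :
    ∑' k, g k * qDiff (q ^ n) 1 q k = ∑ k ∈ Finset.range (n + 1), g k * qDiff (q ^ n) 1 q k := by
  refine tsum_eq_sum fun k hk => ?_
  rw [Finset.mem_range, not_lt] at hk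
  have : qDiff (q ^ n) 1 q k = 0 :=
    Finset.prod_eq_zero (Finset.mem_range.2 (show n < k by omega)) (by simp)
  rw [this, mul_zero]

open Filter Topology in
theorem frequently_nhdsNE_of_eventually_pow {p : ℂ → Prop} (hq0 : q ≠ 0) (hq : ‖q‖ < 1)
    (h : ∀ᶠ n : ℕ in atTop, p (q ^ n)) : ∃ᶠ w in 𝓝[≠] (0 : ℂ), p w := by
  have ht : Tendsto (fun n : ℕ => q ^ n) atTop (𝓝[≠] (0 : ℂ)) :=
    tendsto_nhdsWithin_iff.2 ⟨tendsto_pow_atTop_nhds_zero_of_norm_lt_one hq,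
      .of_forall fun n => pow_ne_zero n hq0⟩
  exact ht.frequently h.frequently

theorem eq_of_differentiableOn_ball {f g : ℂ → ℂ} {U : ℝ} (hU : 0 < U)
    (hf : DifferentiableOn ℂ f (Metric.ball 0 U)) (hg : DifferentiableOn ℂ g (Metric.ball 0 U))
    (h : ∃ᶠ w in nhdsWithin (0 : ℂ) {0}ᶜ, f w = g w) {w : ℂ} (hw : ‖w‖ < U) : f w = g w :=
  (hf.analyticOnNhd Metric.isOpen_ball).eqOn_of_preconnected_of_frequently_eq
    (hg.analyticOnNhd Metric.isOpen_ball) (convex_ball _ _).isPreconnected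
    (Metric.mem_ball_self hU) h (mem_ball_zero_iff.2 hw)

variable {a b c d e f lam : ℂ}

/-- The terminating transformation with its finite factorials absorbed into infinite products by
`qPoch_mul_qPochInf`, in a form that no longer mentions `n` except through `w = q ^ n`. -/
theorem regularized_transformation_pow (hq0 : q ≠ 0) (hq : ‖q‖ < 1) (ha : a ≠ 0)
    (hb : b ≠ 0) (hc : c ≠ 0)
    (hd : d ≠ 0) (he : e ≠ 0) (hlam : lam * (b * c * d) = q * a ^ 2)
    (h1 : ∀ n : ℕ, a * q / b * q ^ n ≠ 1) (h2 : ∀ n : ℕ, a * q / c * q ^ n ≠ 1)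
    (h3 : ∀ n : ℕ, a * q / d * q ^ n ≠ 1) (h4 : ∀ n : ℕ, lam * q * q ^ n ≠ 1)
    (h5 : ∀ n : ℕ, a * q / e * q ^ n ≠ 1) (h6 : ∀ n : ℕ, lam * q / e * q ^ n ≠ 1) (n : ℕ)
    (h7 : ∀ m : ℕ, a * q * q ^ n * q ^ m ≠ 1) :
    qPochInf (a * q / e) q * qPochInf (lam * q) q * qPochInf (lam * q / e * q ^ n) q *
        regularizedSum (a * q) (poisedTerm a b c d e q (lam * q / e)) q (q ^ n) =
      qPochInf (a * q) q * qPochInf (lam * q / e) q * qPochInf (a * q / e * q ^ n) q *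
        regularizedSum (lam * q) (poisedTerm lam (lam * b / a) (lam * c / a) (lam * d / a) e q
          (a * q / e)) q (q ^ n) := by
  have h8 : ∀ m : ℕ, lam * q * q ^ n * q ^ m ≠ 1 := fun m hm => h4 (n + m) (by rw [← hm]; ring)
  rw [regularizedSum_eq hq _ h7, regularizedSum_eq hq _ h8]
  have T := sum_poisedTerm_transformation hq0 (mul_pow_ne_one_self hq) ha hb hc hd he hlam h1 h2 h3
    h4 h5 h6 n h7
  simp only [mul_div_right_comm _ (qDiff (q ^ n) 1 q _)] at T ⊢
  rw [tsum_qDiff_pow, tsum_qDiff_pow, T, ← qPoch_mul_qPochInf (a * q / e) hq n,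
    ← qPoch_mul_qPochInf (lam * q) hq n, ← qPoch_mul_qPochInf (lam * q / e) hq n,
    ← qPoch_mul_qPochInf (a * q) hq n]
  have p1 := qPoch_ne_zero h4 n
  have p2 := qPoch_ne_zero h5 n
  generalize qPoch (a * q / e) q n = x1 at *
  generalize qPoch (lam * q) q n = x2 at *
  generalize ∑ k ∈ Finset.range (n + 1), poisedTerm lam (lam * b / a) (lam * c / a) (lam * d / a) e q
    (a * q / e) k / qPoch (lam * q * q ^ n) q k * qDiff (q ^ n) 1 q k = S
  field_simp

theorem regularized_transformation (hq0 : q ≠ 0) (hq : ‖q‖ < 1) (ha : a ≠ 0)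
    (hb : b ≠ 0) (hc : c ≠ 0)
    (hd : d ≠ 0) (he : e ≠ 0) (hlam : lam * (b * c * d) = q * a ^ 2)
    (h1 : ∀ n : ℕ, a * q / b * q ^ n ≠ 1) (h2 : ∀ n : ℕ, a * q / c * q ^ n ≠ 1)
    (h3 : ∀ n : ℕ, a * q / d * q ^ n ≠ 1) (h4 : ∀ n : ℕ, lam * q * q ^ n ≠ 1)
    (h5 : ∀ n : ℕ, a * q / e * q ^ n ≠ 1) (h6 : ∀ n : ℕ, lam * q / e * q ^ n ≠ 1) {w : ℂ}
    (hL : ‖lam * q / e * w‖ < 1 ∨ HasTerminator q [a * q, b, c, d, e])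
    (hR : ‖a * q / e * w‖ < 1 ∨
      HasTerminator q [lam * q, lam * b / a, lam * c / a, lam * d / a, e]) :
    qPochInf (a * q / e) q * qPochInf (lam * q) q * qPochInf (lam * q / e * w) q *
        regularizedSum (a * q) (poisedTerm a b c d e q (lam * q / e)) q w =
      qPochInf (a * q) q * qPochInf (lam * q / e) q * qPochInf (a * q / e * w) q *
        regularizedSum (lam * q) (poisedTerm lam (lam * b / a) (lam * c / a) (lam * d / a) e q
          (a * q / e)) q w := by
  have hl0 : lam ≠ 0 := by
    rintro rfl
    rw [zero_mul] at hlam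
    exact mul_ne_zero hq0 (pow_ne_zero 2 ha) hlam.symm
  have e1 : lam * q / (lam * b / a) = a * q / b := by field_simp
  have e2 : lam * q / (lam * c / a) = a * q / c := by field_simp
  have e3 : lam * q / (lam * d / a) = a * q / d := by field_simp
  obtain ⟨r, hr0, hr, hrC⟩ := exists_rate_poisedTerm hq h1 h2 h3 h5 hL
  obtain ⟨s, hs0, hs, hsC⟩ := exists_rate_poisedTerm hq (by rwa [e1]) (by rwa [e2]) (by rwa [e3])
    h6 hR
  obtain ⟨U, hwU, hrU, hsU⟩ := exists_gt_mul_lt_one hr hs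
  have hU : 0 < U := (norm_nonneg w).trans_lt hwU
  have hinf : ∀ x : ℂ, DifferentiableOn ℂ (fun w => qPochInf (x * w) q) (Metric.ball 0 U) :=
    fun x => ((differentiable_qPochInf hq).comp
      ((differentiable_const x).mul differentiable_id)).differentiableOn
  refine eq_of_differentiableOn_ball
    (f := fun w => qPochInf (a * q / e) q * qPochInf (lam * q) q * qPochInf (lam * q / e * w) q *
        regularizedSum (a * q) (poisedTerm a b c d e q (lam * q / e)) q w)
    (g := fun w => qPochInf (a * q) q * qPochInf (lam * q / e) q * qPochInf (a * q / e * w) q *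
        regularizedSum (lam * q) (poisedTerm lam (lam * b / a) (lam * c / a) (lam * d / a) e q
          (a * q / e)) q w) hU
    (((hinf _).const_mul _).mul (differentiableOn_regularizedSum hq _ hr0 hU hrU hrC))
    (((hinf _).const_mul _).mul (differentiableOn_regularizedSum hq _ hs0 hU hsU hsC)) ?_ hwU
  apply frequently_nhdsNE_of_eventually_pow hq0 hq
  -- The condition `a q q^n q^m ≠ 1` may fail for small `n` but holds once `|a q q^n| < 1`; an
  -- accumulation at `0` needs only large `n`.
  have hsmall : ∀ᶠ n : ℕ in Filter.atTop, ‖a * q * q ^ n‖ < 1 := by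
    have : Filter.Tendsto (fun n : ℕ => ‖a * q * q ^ n‖) Filter.atTop (nhds 0) := by
      have := ((tendsto_pow_atTop_nhds_zero_of_norm_lt_one hq).const_mul (a * q)).norm
      simpa using this
    exact this.eventually_lt_const one_pos
  filter_upwards [hsmall] with n hn
  exact regularized_transformation_pow hq0 hq ha hb hc hd he hlam h1 h2 h3 h4 h5 h6 n
    (mul_pow_ne_one_of_norm_lt hq hn)

/-- The `k`-th term of a very-well-poised `₈φ₇` series. -/
noncomputable def wellPoisedTerm (a b c d e f q z : ℂ) (k : ℕ) : ℂ :=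
  vwp a q k * qPoch b q k * qPoch c q k * qPoch d q k * qPoch e q k * qPoch f q k * z ^ k /
    (qPoch q q k * qPoch (a * q / b) q k * qPoch (a * q / c) q k * qPoch (a * q / d) q k *
      qPoch (a * q / e) q k * qPoch (a * q / f) q k)

/-- The factor `f ^ (-k)` of the argument homogenizes `(f; q)_k`, so that `f` occurs only through `w
= 1 / f`. -/
theorem wellPoisedTerm_eq (hf : f ≠ 0) (z : ℂ) (k : ℕ) :
    wellPoisedTerm a b c d e f q (z / f) k =
      poisedTerm a b c d e q z k * qDiff f⁻¹ 1 q k / qPoch (a * q * f⁻¹) q k := by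
  rw [← pow_mul_qPoch_div f⁻¹ 1 q (inv_ne_zero hf), one_div, inv_inv, wellPoisedTerm, poisedTerm]
  simp only [div_eq_mul_inv, mul_inv, mul_pow]
  ring

theorem tsum_wellPoisedTerm_transformation (hq0 : q ≠ 0) (hq : ‖q‖ < 1) (ha : a ≠ 0)
    (hb : b ≠ 0) (hc : c ≠ 0)
    (hd : d ≠ 0) (he : e ≠ 0) (hf : f ≠ 0) (hlam : lam * (b * c * d) = q * a ^ 2)
    (h1 : ∀ n : ℕ, a * q / b * q ^ n ≠ 1) (h2 : ∀ n : ℕ, a * q / c * q ^ n ≠ 1)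
    (h3 : ∀ n : ℕ, a * q / d * q ^ n ≠ 1) (h4 : ∀ n : ℕ, lam * q * q ^ n ≠ 1)
    (h5 : ∀ n : ℕ, a * q / e * q ^ n ≠ 1) (h6 : ∀ n : ℕ, lam * q / e * q ^ n ≠ 1)
    (h7 : ∀ n : ℕ, a * q / f * q ^ n ≠ 1) (h8 : ∀ n : ℕ, lam * q / f * q ^ n ≠ 1)
    (h9 : ∀ n : ℕ, lam * q / (e * f) * q ^ n ≠ 1)
    (hL : ‖lam * q / (e * f)‖ < 1 ∨ HasTerminator q [a * q, b, c, d, e, f])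
    (hR : ‖a * q / (e * f)‖ < 1 ∨
      HasTerminator q [lam * q, lam * b / a, lam * c / a, lam * d / a, e, f]) :
    ∑' k, wellPoisedTerm a b c d e f q (lam * q / (e * f)) k =
      qPochInf (a * q) q * qPochInf (a * q / (e * f)) q * qPochInf (lam * q / e) q *
          qPochInf (lam * q / f) q /
        (qPochInf (a * q / e) q * qPochInf (a * q / f) q * qPochInf (lam * q) q *
          qPochInf (lam * q / (e * f)) q) *
      ∑' k, wellPoisedTerm lam (lam * b / a) (lam * c / a) (lam * d / a) e f q
        (a * q / (e * f)) k := by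
  have i1 : a * q * f⁻¹ = a * q / f := (div_eq_mul_inv _ _).symm
  have i2 : lam * q * f⁻¹ = lam * q / f := (div_eq_mul_inv _ _).symm
  have i3 : a * q / e * f⁻¹ = a * q / (e * f) := by field_simp
  have i4 : lam * q / e * f⁻¹ = lam * q / (e * f) := by field_simp
  have main : qPochInf (a * q / e) q * qPochInf (lam * q) q * qPochInf (lam * q / e * f⁻¹) q *
        regularizedSum (a * q) (poisedTerm a b c d e q (lam * q / e)) q f⁻¹ =
      qPochInf (a * q) q * qPochInf (lam * q / e) q * qPochInf (a * q / e * f⁻¹) q *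
        regularizedSum (lam * q) (poisedTerm lam (lam * b / a) (lam * c / a) (lam * d / a) e q
          (a * q / e)) q f⁻¹ := by
    -- If `f` terminates the series, the coefficients without `f` may give no rate, but `1 / f` is
    -- one of the points `q ^ n` where the identity is already known. Otherwise any terminating
    -- parameter lies among the remaining ones.
    by_cases hterm : ∃ n : ℕ, f * q ^ n = 1
    · obtain ⟨n, hn⟩ := hterm
      have hfn : f⁻¹ = q ^ n := inv_eq_of_mul_eq_one_right hn
      rw [hfn]
      refine regularized_transformation_pow hq0 hq ha hb hc hd he hlam h1 h2 h3 h4 h5 h6 n ?_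
      rwa [← hfn, i1]
    · have aux : ∀ {l : List ℂ} {x : ℂ}, ‖x‖ < 1 ∨ HasTerminator q (l ++ [f]) →
          ‖x‖ < 1 ∨ HasTerminator q l := by
        rintro l x (h | ⟨y, hy, m, hm⟩)
        · exact Or.inl h
        · rcases List.mem_append.1 hy with hy | hy
          · exact Or.inr ⟨y, hy, m, hm⟩
          · rw [List.mem_singleton.1 hy] at hm
            exact (hterm ⟨m, hm⟩).elim
      refine regularized_transformation hq0 hq ha hb hc hd he hlam h1 h2 h3 h4 h5 h6
        (aux (by rw [i4]; exact hL)) (aux (by rw [i3]; exact hR))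
  rw [regularizedSum_eq hq _ (by rwa [i1]), regularizedSum_eq hq _ (by rwa [i2])] at main
  simp only [← wellPoisedTerm_eq hf] at main
  rw [i1, i2, i3, i4, div_div, div_div] at main
  have p1 := (qPochInf_ne_zero_iff hq).2 h5
  have p2 := (qPochInf_ne_zero_iff hq).2 h7
  have p3 := (qPochInf_ne_zero_iff hq).2 h4
  have p4 := (qPochInf_ne_zero_iff hq).2 h9
  rw [div_mul_eq_mul_div, eq_div_iff (mul_ne_zero (mul_ne_zero (mul_ne_zero p1 p2) p3) p4)]
  linear_combination main

end Regularized

/-! ### The second transformation by iterating the first. -/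

section SecondTransformation

variable {q a b c d e f lam mu : ℂ}

theorem wellPoisedTerm_permute (z : ℂ) (k : ℕ) :
    wellPoisedTerm a b c d e f q z k = wellPoisedTerm a b e f c d q z k := by
  simp only [wellPoisedTerm, div_eq_mul_inv, mul_inv]
  ring

theorem wellPoisedTerm_reverse (z : ℂ) (k : ℕ) :
    wellPoisedTerm a b c d e f q z k = wellPoisedTerm a f e d c b q z k := by
  simp only [wellPoisedTerm, div_eq_mul_inv, mul_inv]
  ring

/-- The second transformation, by iterating the first, when the intermediate series is
meaningful. -/
theorem second_transformation_of_intermediate (hq0 : q ≠ 0) (hq : ‖q‖ < 1) (ha : a ≠ 0)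
    (hb : b ≠ 0) (hc : c ≠ 0) (hd : d ≠ 0) (he : e ≠ 0) (hf : f ≠ 0)
    (hlam : lam = q * a ^ 2 / (b * c * d))
    (hmu : mu = q ^ 2 * a ^ 3 / (b ^ 2 * c * d * e * f))
    (h1 : ∀ n : ℕ, a * q / b * q ^ n ≠ 1) (h2 : ∀ n : ℕ, a * q / c * q ^ n ≠ 1)
    (h3 : ∀ n : ℕ, a * q / d * q ^ n ≠ 1) (h4 : ∀ n : ℕ, a * q / e * q ^ n ≠ 1)
    (h5 : ∀ n : ℕ, a * q / f * q ^ n ≠ 1)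
    (h6 : ‖lam * q‖ < 1) (h7 : ‖lam * q / e‖ < 1) (h8 : ‖lam * q / f‖ < 1)
    (h9 : ‖b * mu / a‖ < 1) (h10 : ‖a * q / (e * f)‖ < 1) (h11 : ‖mu * q‖ < 1)
    (h12 : ‖b * c * mu / a‖ < 1) (h13 : ‖b * d * mu / a‖ < 1)
    (hR : ‖b‖ < 1 ∨ HasTerminator q [a * q / (b * d), a * q / (b * f)]) :
    qPochInf (a * q / c) q * qPochInf (a * q / d) q * qPochInf (a * q / e) q *
        qPochInf (a * q / f) q * qPochInf (mu * q) q * qPochInf (b * mu / a) q *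
        ∑' k, wellPoisedTerm a b c d e f q (b * mu / a) k =
      qPochInf (a * q) q * qPochInf b q * qPochInf (b * c * mu / a) q *
        qPochInf (b * d * mu / a) q * qPochInf (b * e * mu / a) q * qPochInf (b * f * mu / a) q *
        ∑' k, wellPoisedTerm mu (a * q / (b * c)) (a * q / (b * d)) (a * q / (b * e))
          (a * q / (b * f)) (b * mu / a) q b k := by
  have hl0 : lam ≠ 0 := by rw [hlam]; positivity
  have N := fun {x : ℂ} (hx : ‖x‖ < 1) => mul_pow_ne_one_of_norm_lt hq hx
  have i1 : lam * q / (e * f) = b * mu / a := by rw [hlam, hmu]; field_simp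
  have i2 : lam * q / e = b * f * mu / a := by rw [hlam, hmu]; field_simp
  have i3 : lam * q / f = b * e * mu / a := by rw [hlam, hmu]; field_simp
  have i4 : lam * c / a = a * q / (b * d) := by rw [hlam]; field_simp
  have i5 : lam * d / a = a * q / (b * c) := by rw [hlam]; field_simp
  have i6 : mu * (lam * b / a) / lam = b * mu / a := by field_simp
  have i7 : mu * e / lam = a * q / (b * f) := by rw [hlam, hmu]; field_simp
  have i8 : mu * f / lam = a * q / (b * e) := by rw [hlam, hmu]; field_simp
  have i9 : lam * q / (lam * b / a) = a * q / b := by field_simp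
  have i10 : lam * q / (a * q / (b * d)) = a * q / c := by rw [hlam]; field_simp
  have i11 : lam * q / (a * q / (b * c)) = a * q / d := by rw [hlam]; field_simp
  have i12 : mu * q / (a * q / (b * d)) = b * d * mu / a := by field_simp
  have i13 : mu * q / (a * q / (b * c)) = b * c * mu / a := by field_simp
  have i14 : mu * q / (a * q / (b * d) * (a * q / (b * c))) = a * q / (e * f) := by
    rw [hmu]; field_simp
  have i15 : lam * q / (a * q / (b * d) * (a * q / (b * c))) = b := by rw [hlam]; field_simp
  have A1 := tsum_wellPoisedTerm_transformation hq0 hq ha hb hc hd he hf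
    (lam := lam) (by rw [hlam]; field_simp) h1 h2 h3 (N h6) h4 (N h7) h5 (N h8)
    (by rw [i1]; exact N h9) (Or.inl (by rwa [i1])) (Or.inl h10)
  -- The intermediate series is regrouped: `lam b / a, e, f` now play the role of `b, c, d`. The new
  -- base is `q lam² / ((lam b / a) e f) = mu` and the new argument is `b`.
  have A2 := tsum_wellPoisedTerm_transformation (a := lam) (b := lam * b / a) (c := e) (d := f)
    (e := a * q / (b * d)) (f := a * q / (b * c)) (lam := mu) hq0 hq hl0 (by positivity) he hf
    (by positivity) (by positivity) (by rw [hlam, hmu]; field_simp)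
    (by rwa [i9]) (N h7) (N h8) (N h11) (by rwa [i10]) (by rw [i12]; exact N h13)
    (by rwa [i11]) (by rw [i13]; exact N h12) (by rw [i14]; exact N h10)
    (Or.inl (by rwa [i14])) (by
      rw [i15, i6, i7, i8]
      refine hR.imp id ?_
      rintro ⟨x, hx, m, hm⟩
      refine ⟨x, ?_, m, hm⟩
      simp only [List.mem_cons, List.not_mem_nil, or_false] at hx ⊢
      tauto)
  rw [i4, i5, i1] at A1
  rw [i14, i15, i6, i7, i8, i10, i11, i12, i13] at A2
  simp only [wellPoisedTerm_permute (a := lam) (c := e)] at A2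
  rw [A2] at A1
  rw [i2, i3] at A1
  have p1 := (qPochInf_ne_zero_iff hq).2 h2
  have p2 := (qPochInf_ne_zero_iff hq).2 h3
  have p3 := (qPochInf_ne_zero_iff hq).2 h4
  have p4 := (qPochInf_ne_zero_iff hq).2 h5
  have p5 := (qPochInf_ne_zero_iff hq).2 (N h6)
  have p6 := (qPochInf_ne_zero_iff hq).2 (N h9)
  have p7 := (qPochInf_ne_zero_iff hq).2 (N h10)
  have p8 := (qPochInf_ne_zero_iff hq).2 (N h11)
  have perm : ∀ k, wellPoisedTerm mu (b * mu / a) (a * q / (b * f)) (a * q / (b * e))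
      (a * q / (b * d)) (a * q / (b * c)) q b k = wellPoisedTerm mu (a * q / (b * c))
        (a * q / (b * d)) (a * q / (b * e)) (a * q / (b * f)) (b * mu / a) q b k :=
    fun k => wellPoisedTerm_reverse b k
  simp only [perm] at A1
  -- In the product of the two prefactors, `(lam q; q)_∞` and `(aq/ef; q)_∞` cancel.
  rw [A1]
  generalize ∑' k, wellPoisedTerm mu (a * q / (b * c)) (a * q / (b * d)) (a * q / (b * e))
          (a * q / (b * f)) (b * mu / a) q b k = S
  generalize qPochInf (a * q / c) q = x1 at *
  generalize qPochInf (a * q / d) q = x2 at *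
  generalize qPochInf (a * q / e) q = x3 at *
  generalize qPochInf (a * q / f) q = x4 at *
  generalize qPochInf (lam * q) q = x5 at *
  generalize qPochInf (b * mu / a) q = x6 at *
  generalize qPochInf (a * q / (e * f)) q = x7 at *
  generalize qPochInf (mu * q) q = x8 at *
  generalize qPochInf (a * q) q = x9 at *
  generalize qPochInf (b * c * mu / a) q = x10 at *
  generalize qPochInf (b * d * mu / a) q = x11 at *
  generalize qPochInf (b * e * mu / a) q = x12 at *
  generalize qPochInf (b * f * mu / a) q = x13 at *
  clear * - p1 p2 p3 p4 p5 p6 p7 p8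
  field_simp

/-! ### Removing the intermediate conditions by scaling `c` and `e`. -/

/-- The left-hand side of the second transformation with `c, e` replaced by `c / w, e / w`,
multiplied by its denominators. -/
noncomputable def scaledLeft (a b c d e f z q : ℂ) (k : ℕ) (w : ℂ) : ℂ :=
  vwp a q k * qPoch b q k * qPoch d q k * qPoch f q k * z ^ k /
      (qPoch q q k * qPoch (a * q / b) q k * qPoch (a * q / d) q k * qPoch (a * q / f) q k) *
    (qDiff w c q k * qDiff w e q k) *
    (qPochInf (a * q / c * w * q ^ k) q * qPochInf (a * q / e * w * q ^ k) q)

/-- The right-hand side of the second transformation with `c, e` replaced by `c / w, e / w`,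
multiplied by its denominators. -/
noncomputable def scaledRight (a b c d e f mu q : ℂ) (k : ℕ) (w : ℂ) : ℂ :=
  qPoch (a * q / (b * d)) q k * qPoch (a * q / (b * f)) q k * b ^ k /
      (qPoch q q k * qPoch (a * q / b) q k) *
    (vwp (mu * w ^ 2) q k * qPoch (a * q / (b * c) * w) q k * qPoch (a * q / (b * e) * w) q k *
      qPoch (b * mu / a * w ^ 2) q k) *
    (qPochInf (b * c * mu / a * w * q ^ k) q * qPochInf (b * d * mu / a * w ^ 2 * q ^ k) q *
      qPochInf (b * e * mu / a * w * q ^ k) q * qPochInf (b * f * mu / a * w ^ 2 * q ^ k) q)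

/-- The argument acquires `w ^ 2`; its two factors `w ^ k` homogenize `(c / w; q)_k` and `(e / w;
q)_k`, so the summand is regular at `w = 0`. -/
theorem tsum_scaledLeft (hq : ‖q‖ < 1) {w z : ℂ} (hw : w ≠ 0)
    (h1 : ∀ n : ℕ, a * q / c * w * q ^ n ≠ 1) (h2 : ∀ n : ℕ, a * q / e * w * q ^ n ≠ 1) :
    ∑' k, scaledLeft a b c d e f z q k w =
      qPochInf (a * q / c * w) q * qPochInf (a * q / e * w) q *
        ∑' k, wellPoisedTerm a b (c / w) d (e / w) f q (z * w ^ 2) k := by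
  rw [← tsum_mul_left]
  refine tsum_congr fun k => ?_
  have e1 : a * q / (c / w) = a * q / c * w := by rw [div_div_eq_mul_div, div_mul_eq_mul_div]
  have e2 : a * q / (e / w) = a * q / e * w := by rw [div_div_eq_mul_div, div_mul_eq_mul_div]
  rw [wellPoisedTerm, e1, e2, scaledLeft, ← qPoch_mul_qPochInf (a * q / c * w) hq k,
    ← qPoch_mul_qPochInf (a * q / e * w) hq k, ← pow_mul_qPoch_div w c q hw,
    ← pow_mul_qPoch_div w e q hw, mul_pow, ← pow_mul, mul_comm 2 k, pow_mul]
  have p1 := mul_inv_cancel₀ (qPoch_ne_zero h1 k)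
  have p2 := mul_inv_cancel₀ (qPoch_ne_zero h2 k)
  generalize qPoch (a * q / c * w) q k = x at *
  generalize qPoch (a * q / e * w) q k = y at *
  calc _ = (x * x⁻¹) * (y * y⁻¹) * (vwp a q k * qPoch b q k * qPoch d q k * qPoch f q k * z ^ k /
      (qPoch q q k * qPoch (a * q / b) q k * qPoch (a * q / d) q k * qPoch (a * q / f) q k) *
    (w ^ k * qPoch (c / w) q k * (w ^ k * qPoch (e / w) q k)) *
    (qPochInf (a * q / c * w * q ^ k) q * qPochInf (a * q / e * w * q ^ k) q)) := by
        rw [p1, p2, one_mul, one_mul]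
    _ = _ := by
        simp only [div_eq_mul_inv, mul_inv]
        ring

/-- Here `mu` becomes `mu w²` while the argument `b` and the lower parameter `aq/b` stay fixed, so
`w` enters only through entire factors. -/
theorem tsum_scaledRight (hq0 : q ≠ 0) (hq : ‖q‖ < 1) (ha : a ≠ 0) (hb : b ≠ 0) (hc : c ≠ 0)
    (hd : d ≠ 0) (he : e ≠ 0) (hf : f ≠ 0) (hmu : mu ≠ 0) {w : ℂ} (hw : w ≠ 0)
    (h1 : ∀ n : ℕ, b * c * mu / a * w * q ^ n ≠ 1)
    (h2 : ∀ n : ℕ, b * d * mu / a * w ^ 2 * q ^ n ≠ 1)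
    (h3 : ∀ n : ℕ, b * e * mu / a * w * q ^ n ≠ 1)
    (h4 : ∀ n : ℕ, b * f * mu / a * w ^ 2 * q ^ n ≠ 1) :
    ∑' k, scaledRight a b c d e f mu q k w =
      qPochInf (b * c * mu / a * w) q * qPochInf (b * d * mu / a * w ^ 2) q *
        qPochInf (b * e * mu / a * w) q * qPochInf (b * f * mu / a * w ^ 2) q *
        ∑' k, wellPoisedTerm (mu * w ^ 2) (a * q / (b * c) * w) (a * q / (b * d))
          (a * q / (b * e) * w) (a * q / (b * f)) (b * mu / a * w ^ 2) q b k := by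
  rw [← tsum_mul_left]
  refine tsum_congr fun k => ?_
  have e1 : mu * w ^ 2 * q / (a * q / (b * c) * w) = b * c * mu / a * w := by field_simp
  have e2 : mu * w ^ 2 * q / (a * q / (b * d)) = b * d * mu / a * w ^ 2 := by field_simp
  have e3 : mu * w ^ 2 * q / (a * q / (b * e) * w) = b * e * mu / a * w := by field_simp
  have e4 : mu * w ^ 2 * q / (a * q / (b * f)) = b * f * mu / a * w ^ 2 := by field_simp
  have e5 : mu * w ^ 2 * q / (b * mu / a * w ^ 2) = a * q / b := by field_simp
  rw [wellPoisedTerm, e1, e2, e3, e4, e5, scaledRight,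
    ← qPoch_mul_qPochInf (b * c * mu / a * w) hq k,
    ← qPoch_mul_qPochInf (b * d * mu / a * w ^ 2) hq k,
    ← qPoch_mul_qPochInf (b * e * mu / a * w) hq k,
    ← qPoch_mul_qPochInf (b * f * mu / a * w ^ 2) hq k]
  have p1 := mul_inv_cancel₀ (qPoch_ne_zero h1 k)
  have p2 := mul_inv_cancel₀ (qPoch_ne_zero h2 k)
  have p3 := mul_inv_cancel₀ (qPoch_ne_zero h3 k)
  have p4 := mul_inv_cancel₀ (qPoch_ne_zero h4 k)
  generalize qPoch (b * c * mu / a * w) q k = x1 at *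
  generalize qPoch (b * d * mu / a * w ^ 2) q k = x2 at *
  generalize qPoch (b * e * mu / a * w) q k = x3 at *
  generalize qPoch (b * f * mu / a * w ^ 2) q k = x4 at *
  calc _ = (x1 * x1⁻¹) * (x2 * x2⁻¹) * (x3 * x3⁻¹) * (x4 * x4⁻¹) *
      (qPoch (a * q / (b * d)) q k * qPoch (a * q / (b * f)) q k * b ^ k /
      (qPoch q q k * qPoch (a * q / b) q k) *
    (vwp (mu * w ^ 2) q k * qPoch (a * q / (b * c) * w) q k * qPoch (a * q / (b * e) * w) q k *
      qPoch (b * mu / a * w ^ 2) q k) *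
    (qPochInf (b * c * mu / a * w * q ^ k) q * qPochInf (b * d * mu / a * w ^ 2 * q ^ k) q *
      qPochInf (b * e * mu / a * w * q ^ k) q * qPochInf (b * f * mu / a * w ^ 2 * q ^ k) q)) := by
        rw [p1, p2, p3, p4, one_mul, one_mul, one_mul, one_mul]
    _ = _ := by
        simp only [div_eq_mul_inv, mul_inv]
        ring

end SecondTransformation

section SecondTransformation

variable {q a b c d e f mu : ℂ}

theorem exists_rate_lt_one {g : ℕ → ℂ} {z : ℂ}
    (h : (‖z‖ < 1 ∧ ∃ C : ℝ, 0 ≤ C ∧ ∀ k, ‖g k‖ ≤ C * ‖z‖ ^ k) ∨ ∃ N, ∀ k, N ≤ k → g k = 0) :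
    ∃ r : ℝ, 0 ≤ r ∧ r < 1 ∧ ∃ C : ℝ, 0 ≤ C ∧ ∀ k, ‖g k‖ ≤ C * r ^ k := by
  rcases h with ⟨h, hC⟩ | ⟨N, hN⟩
  · exact ⟨‖z‖, norm_nonneg _, h, hC⟩
  · exact ⟨1 / 2, by norm_num, by norm_num, exists_bound_of_eventually_zero hN (by norm_num)⟩

/-- A terminating `c` or `e` is of no use here, since `c / w` and `e / w` move with `w`. -/
theorem exists_rate_scaledLeft (hq : ‖q‖ < 1) (h1 : ∀ n : ℕ, a * q / b * q ^ n ≠ 1)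
    (h2 : ∀ n : ℕ, a * q / d * q ^ n ≠ 1) (h3 : ∀ n : ℕ, a * q / f * q ^ n ≠ 1) {z : ℂ}
    (h : ‖z‖ < 1 ∨ HasTerminator q [a * q, d, f]) :
    ∃ r : ℝ, 0 ≤ r ∧ r < 1 ∧ ∃ C : ℝ, 0 ≤ C ∧ ∀ k,
      ‖vwp a q k * qPoch b q k * qPoch d q k * qPoch f q k * z ^ k /
        (qPoch q q k * qPoch (a * q / b) q k * qPoch (a * q / d) q k * qPoch (a * q / f) q k)‖
        ≤ C * r ^ k := by
  refine exists_rate_lt_one (z := z) ?_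
  rcases h with h | ⟨x, hx, m, hm⟩
  · refine Or.inl ⟨h, ?_⟩
    have hv : GeomAnalytic (fun k _ => vwp a q k) Set.univ 1 :=
      geomAnalytic_vwp hq (differentiableOn_const a) fun _ _ => le_rfl
    have u := fun x => geomAnalytic_const_qPoch hq x Set.univ
    have l := fun {x : ℂ} (hx : ∀ n : ℕ, x * q ^ n ≠ 1) =>
      geomAnalytic_const_qPoch_inv hq hx Set.univ
    obtain ⟨C, hC, hb⟩ := (((((hv.mul (u b)).mul (u d)).mul (u f)).mul
      (geomAnalytic_const_pow z _)).mul
      ((((l (mul_pow_ne_one_self hq)).mul (l h1)).mul (l h2)).mul (l h3))).bound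
    refine ⟨C, hC, fun k => ?_⟩
    have := hb k 0 trivial
    rw [div_eq_mul_inv]
    simp only [one_mul, mul_one] at this
    simpa only [mul_inv] using this
  · refine Or.inr ⟨m + 2, fun k hk => ?_⟩
    simp only [List.mem_cons, List.not_mem_nil, or_false] at hx
    rcases hx with rfl | rfl | rfl
    · rw [vwp_eq_zero_of_le hm hk]; simp
    all_goals rw [qPoch_eq_zero_of_le hm (by omega)]; simp

theorem exists_rate_scaledRight (hq : ‖q‖ < 1) {x y v b : ℂ} (h1 : ∀ n : ℕ, v * q ^ n ≠ 1)
    (h : ‖b‖ < 1 ∨ HasTerminator q [x, y]) :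
    ∃ r : ℝ, 0 ≤ r ∧ r < 1 ∧ ∃ C : ℝ, 0 ≤ C ∧ ∀ k,
      ‖qPoch x q k * qPoch y q k * b ^ k / (qPoch q q k * qPoch v q k)‖ ≤ C * r ^ k := by
  refine exists_rate_lt_one (z := b) ?_
  rcases h with h | ⟨t, ht, m, hm⟩
  · refine Or.inl ⟨h, ?_⟩
    have u := fun x => geomAnalytic_const_qPoch hq x Set.univ
    have l := fun {x : ℂ} (hx : ∀ n : ℕ, x * q ^ n ≠ 1) =>
      geomAnalytic_const_qPoch_inv hq hx Set.univ
    obtain ⟨C, hC, hb⟩ := ((((u x).mul (u y)).mul (geomAnalytic_const_pow b _)).mul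
      ((l (mul_pow_ne_one_self hq)).mul (l h1))).bound
    refine ⟨C, hC, fun k => ?_⟩
    have := hb k 0 trivial
    rw [div_eq_mul_inv]
    simp only [one_mul, mul_one] at this
    simpa only [mul_inv] using this
  · refine Or.inr ⟨m + 1, fun k hk => ?_⟩
    simp only [List.mem_cons, List.not_mem_nil, or_false] at ht
    rcases ht with rfl | rfl
    all_goals rw [qPoch_eq_zero_of_le hm (by omega)]; simp

theorem norm_const_mul_pow_le {U : ℝ} {w : ℂ} (hw : w ∈ Metric.ball (0 : ℂ) U) (x : ℂ) (p : ℕ) :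
    ‖x * w ^ p‖ ≤ ‖x‖ * U ^ p := by
  rw [norm_mul, norm_pow]
  gcongr
  exact (mem_ball_zero_iff.1 hw).le

theorem differentiableOn_tsum_scaledLeft (hq : ‖q‖ < 1) {z : ℂ} {r U : ℝ} (hr0 : 0 ≤ r)
    (hU : 0 < U) (hrU : r * U ^ 2 < 1)
    (hr : ∃ C : ℝ, 0 ≤ C ∧ ∀ k,
      ‖vwp a q k * qPoch b q k * qPoch d q k * qPoch f q k * z ^ k /
        (qPoch q q k * qPoch (a * q / b) q k * qPoch (a * q / d) q k * qPoch (a * q / f) q k)‖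
        ≤ C * r ^ k) :
    DifferentiableOn ℂ (fun w => ∑' k, scaledLeft a b c d e f z q k w) (Metric.ball 0 U) := by
  have hid : ∀ w ∈ Metric.ball (0 : ℂ) U, ‖w‖ ≤ U := fun w hw => (mem_ball_zero_iff.1 hw).le
  have D := fun x => geomAnalytic_qDiff hq hU (differentiableOn_id (𝕜 := ℂ) (E := ℂ)
    (s := Metric.ball 0 U)) (differentiableOn_const x) hid (fun _ _ => le_rfl)
  have I := fun x : ℂ => geomAnalytic_qPochInf hq (s := Metric.ball 0 U) (g := fun w => x * w)
    (by fun_prop) (fun w hw => by simpa using norm_const_mul_pow_le hw x 1)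
  have h : GeomAnalytic (scaledLeft a b c d e f z q) (Metric.ball 0 U)
      (r * (U * U) * (1 * 1)) :=
    ((GeomAnalytic.const _ hr).mul ((D c).mul (D e))).mul ((I (a * q / c)).mul (I (a * q / e)))
  exact h.differentiableOn_tsum Metric.isOpen_ball (by positivity) (by linarith [hrU, sq U])

/-- All factors containing `w` are bounded uniformly in `k` on any disc, so the radius `U` is
unrestricted. On the left, by contrast, the two `qDiff` factors cost `U ^ 2`. -/
theorem differentiableOn_tsum_scaledRight (hq : ‖q‖ < 1) {r U : ℝ} (hr0 : 0 ≤ r) (hr1 : r < 1)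
    (hr : ∃ C : ℝ, 0 ≤ C ∧ ∀ k,
      ‖qPoch (a * q / (b * d)) q k * qPoch (a * q / (b * f)) q k * b ^ k /
        (qPoch q q k * qPoch (a * q / b) q k)‖ ≤ C * r ^ k) :
    DifferentiableOn ℂ (fun w => ∑' k, scaledRight a b c d e f mu q k w) (Metric.ball 0 U) := by
  have V := geomAnalytic_vwp hq (s := Metric.ball 0 U) (g := fun w => mu * w ^ 2)
    (by fun_prop) (fun w hw => norm_const_mul_pow_le hw mu 2)
  have P1 := fun x : ℂ => geomAnalytic_qPoch hq (s := Metric.ball 0 U) (g := fun w => x * w)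
    (by fun_prop) (fun w hw => by simpa using norm_const_mul_pow_le hw x 1)
  have P2 := fun x : ℂ => geomAnalytic_qPoch hq (s := Metric.ball 0 U) (g := fun w => x * w ^ 2)
    (by fun_prop) (fun w hw => norm_const_mul_pow_le hw x 2)
  have I1 := fun x : ℂ => geomAnalytic_qPochInf hq (s := Metric.ball 0 U) (g := fun w => x * w)
    (by fun_prop) (fun w hw => by simpa using norm_const_mul_pow_le hw x 1)
  have I2 := fun x : ℂ => geomAnalytic_qPochInf hq (s := Metric.ball 0 U)
    (g := fun w => x * w ^ 2) (by fun_prop) (fun w hw => norm_const_mul_pow_le hw x 2)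
  have h : GeomAnalytic (scaledRight a b c d e f mu q) (Metric.ball 0 U)
      (r * (1 * 1 * 1 * 1) * (1 * 1 * 1 * 1)) :=
    ((GeomAnalytic.const _ hr).mul (((V.mul (P1 (a * q / (b * c)))).mul
      (P1 (a * q / (b * e)))).mul (P2 (b * mu / a)))).mul
      ((((I1 (b * c * mu / a)).mul (I2 (b * d * mu / a))).mul (I1 (b * e * mu / a))).mul
        (I2 (b * f * mu / a)))
  exact h.differentiableOn_tsum Metric.isOpen_ball (by positivity) (by simpa using hr1)

open Filter Topology in
theorem eventually_norm_mul_pow_lt (x : ℂ) {p : ℕ} (hp : p ≠ 0) :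
    ∀ᶠ w in 𝓝[≠] (0 : ℂ), ‖x * w ^ p‖ < 1 := by
  have h : ContinuousAt (fun w : ℂ => ‖x * w ^ p‖) 0 := by fun_prop
  refine (h.eventually_lt_const ?_).filter_mono nhdsWithin_le_nhds
  simp [hp]

/-- Scaling multiplies `lam` by `w`, `mu` by `w²`, and every quantity in the intermediate conditions
by `w` or `w²`. All of them are therefore less than one in norm near `w = 0`. -/
theorem second_transformation_scaled (hq0 : q ≠ 0) (hq : ‖q‖ < 1) (ha : a ≠ 0)
    (hb : b ≠ 0) (hc : c ≠ 0) (hd : d ≠ 0) (he : e ≠ 0) (hf : f ≠ 0)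
    (hmu : mu = q ^ 2 * a ^ 3 / (b ^ 2 * c * d * e * f))
    (h1 : ∀ n : ℕ, a * q / b * q ^ n ≠ 1) (h3 : ∀ n : ℕ, a * q / d * q ^ n ≠ 1)
    (h5 : ∀ n : ℕ, a * q / f * q ^ n ≠ 1)
    (hR : ‖b‖ < 1 ∨ HasTerminator q [a * q / (b * d), a * q / (b * f)]) :
    ∀ᶠ w in nhdsWithin (0 : ℂ) {0}ᶜ,
      qPochInf (a * q / d) q * qPochInf (a * q / f) q * qPochInf (mu * q * w ^ 2) q *
          qPochInf (b * mu / a * w ^ 2) q *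
          ∑' k, scaledLeft a b c d e f (b * mu / a) q k w =
        qPochInf (a * q) q * qPochInf b q * ∑' k, scaledRight a b c d e f mu q k w := by
  have hmu0 : mu ≠ 0 := by rw [hmu]; positivity
  have E1 := fun x => eventually_norm_mul_pow_lt x one_ne_zero
  have E2 := fun x => eventually_norm_mul_pow_lt x two_ne_zero
  filter_upwards [E1 (a * q / c), E1 (a * q / e), E1 (q * a ^ 2 / (b * c * d) * q),
    E2 (q * a ^ 2 / (b * c * d) * q / e), E1 (q * a ^ 2 / (b * c * d) * q / f),
    E2 (b * mu / a), E1 (a * q / (e * f)), E2 (mu * q), E1 (b * c * mu / a),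
    E2 (b * d * mu / a), E1 (b * e * mu / a), E2 (b * f * mu / a), self_mem_nhdsWithin]
    with w k1 k2 k3 k4 k5 k6 k7 k8 k9 k10 k11 k12 hw
  replace hw : w ≠ 0 := hw
  rw [pow_one] at k1 k2 k3 k5 k7 k9 k11
  have N := fun {x : ℂ} (hx : ‖x‖ < 1) => mul_pow_ne_one_of_norm_lt hq hx
  rw [tsum_scaledLeft hq hw (N k1) (N k2),
    tsum_scaledRight hq0 hq ha hb hc hd he hf hmu0 hw (N k9) (N k10) (N k11) (N k12)]
  have j1 : a * q / (c / w) = a * q / c * w := by field_simp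
  have j2 : a * q / (e / w) = a * q / e * w := by field_simp
  have j3 : q * a ^ 2 / (b * (c / w) * d) * q = q * a ^ 2 / (b * c * d) * q * w := by field_simp
  have j4 : q * a ^ 2 / (b * (c / w) * d) * q / (e / w)
      = q * a ^ 2 / (b * c * d) * q / e * w ^ 2 := by field_simp
  have j5 : q * a ^ 2 / (b * (c / w) * d) * q / f = q * a ^ 2 / (b * c * d) * q / f * w := by
    field_simp
  have j6 : b * (mu * w ^ 2) / a = b * mu / a * w ^ 2 := by field_simp
  have j7 : a * q / (e / w * f) = a * q / (e * f) * w := by field_simp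
  have j8 : mu * w ^ 2 * q = mu * q * w ^ 2 := by ring
  have j9 : b * (c / w) * (mu * w ^ 2) / a = b * c * mu / a * w := by field_simp
  have j10 : b * d * (mu * w ^ 2) / a = b * d * mu / a * w ^ 2 := by field_simp
  have j11 : b * (e / w) * (mu * w ^ 2) / a = b * e * mu / a * w := by field_simp
  have j12 : b * f * (mu * w ^ 2) / a = b * f * mu / a * w ^ 2 := by field_simp
  have j13 : a * q / (b * (c / w)) = a * q / (b * c) * w := by field_simp
  have j14 : a * q / (b * (e / w)) = a * q / (b * e) * w := by field_simp
  have B := second_transformation_of_intermediate (c := c / w) (e := e / w) (mu := mu * w ^ 2)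
    hq0 hq ha hb (div_ne_zero hc hw) hd (div_ne_zero he hw) hf rfl
    (by rw [hmu]; field_simp) h1 (by rw [j1]; exact N k1) h3 (by rw [j2]; exact N k2) h5
    (by rwa [j3]) (by rwa [j4]) (by rwa [j5]) (by rwa [j6]) (by rwa [j7]) (by rwa [j8])
    (by rwa [j9]) (by rwa [j10]) hR
  rw [j1, j2, j6, j8, j9, j10, j11, j12, j13, j14] at B
  linear_combination B

/-- The second transformation, the terminating parameters, if needed, being among `d`, `f`. -/
theorem second_transformation (hq0 : q ≠ 0) (hq : ‖q‖ < 1) (ha : a ≠ 0)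
    (hb : b ≠ 0) (hc : c ≠ 0) (hd : d ≠ 0) (he : e ≠ 0) (hf : f ≠ 0)
    (hmu : mu = q ^ 2 * a ^ 3 / (b ^ 2 * c * d * e * f))
    (h1 : ∀ n : ℕ, a * q / b * q ^ n ≠ 1) (h2 : ∀ n : ℕ, a * q / c * q ^ n ≠ 1)
    (h3 : ∀ n : ℕ, a * q / d * q ^ n ≠ 1) (h4 : ∀ n : ℕ, a * q / e * q ^ n ≠ 1)
    (h5 : ∀ n : ℕ, a * q / f * q ^ n ≠ 1)
    (h6 : ∀ n : ℕ, b * c * mu / a * q ^ n ≠ 1) (h7 : ∀ n : ℕ, b * d * mu / a * q ^ n ≠ 1)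
    (h8 : ∀ n : ℕ, b * e * mu / a * q ^ n ≠ 1) (h9 : ∀ n : ℕ, b * f * mu / a * q ^ n ≠ 1)
    (hL : ‖b * mu / a‖ < 1 ∨ HasTerminator q [a * q, d, f])
    (hR : ‖b‖ < 1 ∨ HasTerminator q [a * q / (b * d), a * q / (b * f)]) :
    qPochInf (a * q / c) q * qPochInf (a * q / d) q * qPochInf (a * q / e) q *
        qPochInf (a * q / f) q * qPochInf (mu * q) q * qPochInf (b * mu / a) q *
        ∑' k, wellPoisedTerm a b c d e f q (b * mu / a) k =
      qPochInf (a * q) q * qPochInf b q * qPochInf (b * c * mu / a) q *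
        qPochInf (b * d * mu / a) q * qPochInf (b * e * mu / a) q * qPochInf (b * f * mu / a) q *
        ∑' k, wellPoisedTerm mu (a * q / (b * c)) (a * q / (b * d)) (a * q / (b * e))
          (a * q / (b * f)) (b * mu / a) q b k := by
  have hmu0 : mu ≠ 0 := by rw [hmu]; positivity
  obtain ⟨r, hr0, hr1, hr⟩ := exists_rate_scaledLeft hq h1 h3 h5 hL
  obtain ⟨s, hs0, hs1, hs⟩ := exists_rate_scaledRight hq h1 hR
  -- The disc must contain `w = 1`, the unscaled case; `r < 1` allows a radius slightly larger than
  -- one.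
  obtain ⟨U, hU1, hrU⟩ : ∃ U : ℝ, 1 < U ∧ r * U ^ 2 < 1 := by
    have h : ContinuousAt (fun U : ℝ => r * U ^ 2) 1 := by fun_prop
    have h' := (h.eventually_lt_const (show r * 1 ^ 2 < 1 by simpa using hr1)).filter_mono
      (nhdsWithin_le_nhds (s := Set.Ioi 1))
    have h3 : ∀ᶠ U in nhdsWithin (1 : ℝ) (Set.Ioi 1), 1 < U := self_mem_nhdsWithin
    exact (h3.and h').exists
  have hU : 0 < U := one_pos.trans hU1
  have hinf : ∀ x : ℂ, DifferentiableOn ℂ (fun w => qPochInf (x * w ^ 2) q) (Metric.ball 0 U) :=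
    fun x => (differentiable_qPochInf hq).comp_differentiableOn (by fun_prop)
  have main := eq_of_differentiableOn_ball hU
    ((((hinf (mu * q)).const_mul (qPochInf (a * q / d) q * qPochInf (a * q / f) q)).mul
      (hinf (b * mu / a))).mul
        (differentiableOn_tsum_scaledLeft (c := c) (e := e) hq hr0 hU hrU hr))
    ((differentiableOn_tsum_scaledRight (c := c) (e := e) (mu := mu) (U := U) hq hs0 hs1
      hs).const_mul (qPochInf (a * q) q * qPochInf b q))
    (second_transformation_scaled hq0 hq ha hb hc hd he hf hmu h1 h3 h5 hR).frequently
    (w := 1) (by simpa using hU1)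
  simp only [Pi.mul_apply] at main
  rw [tsum_scaledLeft hq one_ne_zero (by simpa using h2) (by simpa using h4),
    tsum_scaledRight hq0 hq ha hb hc hd he hf hmu0 one_ne_zero (by simpa using h6)
      (by simpa using h7) (by simpa using h8) (by simpa using h9)] at main
  simp only [one_pow, mul_one, div_one] at main
  linear_combination main

end SecondTransformation

/-! ### Placing the terminating parameters by symmetry. -/

section SecondTransformation

variable {q a b c d e f mu : ℂ}

/-- The identity is symmetric in `c, d, e, f`. A terminating parameter on the right can be moved to
the `f` position by a swap that leaves `d`, reserved for the left series, in place. -/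
theorem second_transformation_of_terminator (hq0 : q ≠ 0) (hq : ‖q‖ < 1) (ha : a ≠ 0)
    (hb : b ≠ 0) (hc : c ≠ 0) (hd : d ≠ 0) (he : e ≠ 0) (hf : f ≠ 0)
    (hmu : mu = q ^ 2 * a ^ 3 / (b ^ 2 * c * d * e * f))
    (h1 : ∀ n : ℕ, a * q / b * q ^ n ≠ 1) (h2 : ∀ n : ℕ, a * q / c * q ^ n ≠ 1)
    (h3 : ∀ n : ℕ, a * q / d * q ^ n ≠ 1) (h4 : ∀ n : ℕ, a * q / e * q ^ n ≠ 1)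
    (h5 : ∀ n : ℕ, a * q / f * q ^ n ≠ 1)
    (h6 : ∀ n : ℕ, b * c * mu / a * q ^ n ≠ 1) (h7 : ∀ n : ℕ, b * d * mu / a * q ^ n ≠ 1)
    (h8 : ∀ n : ℕ, b * e * mu / a * q ^ n ≠ 1) (h9 : ∀ n : ℕ, b * f * mu / a * q ^ n ≠ 1)
    (hL : ‖b * mu / a‖ < 1 ∨ HasTerminator q [a * q, d])
    (hR : ‖b‖ < 1 ∨ HasTerminator q
      [a * q / (b * c), a * q / (b * d), a * q / (b * e), a * q / (b * f)]) :
    qPochInf (a * q / c) q * qPochInf (a * q / d) q * qPochInf (a * q / e) q *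
        qPochInf (a * q / f) q * qPochInf (mu * q) q * qPochInf (b * mu / a) q *
        ∑' k, wellPoisedTerm a b c d e f q (b * mu / a) k =
      qPochInf (a * q) q * qPochInf b q * qPochInf (b * c * mu / a) q *
        qPochInf (b * d * mu / a) q * qPochInf (b * e * mu / a) q * qPochInf (b * f * mu / a) q *
        ∑' k, wellPoisedTerm mu (a * q / (b * c)) (a * q / (b * d)) (a * q / (b * e))
          (a * q / (b * f)) (b * mu / a) q b k := by
  have hL' : ∀ x, ‖b * mu / a‖ < 1 ∨ HasTerminator q [a * q, d, x] := fun x => by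
    refine hL.imp id ?_
    rintro ⟨y, hy, m, hm⟩
    refine ⟨y, ?_, m, hm⟩
    simp only [List.mem_cons, List.not_mem_nil, or_false] at hy ⊢
    tauto
  rcases hR with hR | ⟨y, hy, m, hm⟩
  · exact second_transformation hq0 hq ha hb hc hd he hf hmu h1 h2 h3 h4 h5 h6 h7 h8 h9 (hL' f)
      (Or.inl hR)
  simp only [List.mem_cons, List.not_mem_nil, or_false] at hy
  rcases hy with hy | hy | hy | hy
  · have := second_transformation (c := f) (f := c) hq0 hq ha hb hf hd he hc
      (by rw [hmu]; ring) h1 h5 h3 h4 h2 h9 h7 h8 h6 (hL' c)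
      (Or.inr ⟨y, by simp [hy], m, hm⟩)
    have s1 : ∀ k, wellPoisedTerm a b f d e c q (b * mu / a) k =
        wellPoisedTerm a b c d e f q (b * mu / a) k := fun k => by
      simp only [wellPoisedTerm, div_eq_mul_inv, mul_inv]; ring
    have s2 : ∀ k, wellPoisedTerm mu (a * q / (b * f)) (a * q / (b * d)) (a * q / (b * e))
          (a * q / (b * c)) (b * mu / a) q b k =
        wellPoisedTerm mu (a * q / (b * c)) (a * q / (b * d)) (a * q / (b * e))
          (a * q / (b * f)) (b * mu / a) q b k := fun k => by
      simp only [wellPoisedTerm, div_eq_mul_inv, mul_inv]; ring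
    simp only [s1, s2] at this
    linear_combination this
  · exact second_transformation hq0 hq ha hb hc hd he hf hmu h1 h2 h3 h4 h5 h6 h7 h8 h9 (hL' f)
      (Or.inr ⟨y, by simp [hy], m, hm⟩)
  · have := second_transformation (e := f) (f := e) hq0 hq ha hb hc hd hf he
      (by rw [hmu]; ring) h1 h2 h3 h5 h4 h6 h7 h9 h8 (hL' e)
      (Or.inr ⟨y, by simp [hy], m, hm⟩)
    have s1 : ∀ k, wellPoisedTerm a b c d f e q (b * mu / a) k =
        wellPoisedTerm a b c d e f q (b * mu / a) k := fun k => by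
      simp only [wellPoisedTerm, div_eq_mul_inv, mul_inv]; ring
    have s2 : ∀ k, wellPoisedTerm mu (a * q / (b * c)) (a * q / (b * d)) (a * q / (b * f))
          (a * q / (b * e)) (b * mu / a) q b k =
        wellPoisedTerm mu (a * q / (b * c)) (a * q / (b * d)) (a * q / (b * e))
          (a * q / (b * f)) (b * mu / a) q b k := fun k => by
      simp only [wellPoisedTerm, div_eq_mul_inv, mul_inv]; ring
    simp only [s1, s2] at this
    linear_combination this
  · exact second_transformation hq0 hq ha hb hc hd he hf hmu h1 h2 h3 h4 h5 h6 h7 h8 h9 (hL' f)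
      (Or.inr ⟨y, by simp [hy], m, hm⟩)

/-- A swap brings the terminating parameter on the left to the `d` position; the list for the right
series is only permuted. -/
theorem second_transformation_of_terminators (hq0 : q ≠ 0) (hq : ‖q‖ < 1) (ha : a ≠ 0)
    (hb : b ≠ 0) (hc : c ≠ 0) (hd : d ≠ 0) (he : e ≠ 0) (hf : f ≠ 0)
    (hmu : mu = q ^ 2 * a ^ 3 / (b ^ 2 * c * d * e * f))
    (h1 : ∀ n : ℕ, a * q / b * q ^ n ≠ 1) (h2 : ∀ n : ℕ, a * q / c * q ^ n ≠ 1)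
    (h3 : ∀ n : ℕ, a * q / d * q ^ n ≠ 1) (h4 : ∀ n : ℕ, a * q / e * q ^ n ≠ 1)
    (h5 : ∀ n : ℕ, a * q / f * q ^ n ≠ 1)
    (h6 : ∀ n : ℕ, b * c * mu / a * q ^ n ≠ 1) (h7 : ∀ n : ℕ, b * d * mu / a * q ^ n ≠ 1)
    (h8 : ∀ n : ℕ, b * e * mu / a * q ^ n ≠ 1) (h9 : ∀ n : ℕ, b * f * mu / a * q ^ n ≠ 1)
    (hL : ‖b * mu / a‖ < 1 ∨ HasTerminator q [a * q, c, d, e, f])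
    (hR : ‖b‖ < 1 ∨ HasTerminator q
      [a * q / (b * c), a * q / (b * d), a * q / (b * e), a * q / (b * f)]) :
    qPochInf (a * q / c) q * qPochInf (a * q / d) q * qPochInf (a * q / e) q *
        qPochInf (a * q / f) q * qPochInf (mu * q) q * qPochInf (b * mu / a) q *
        ∑' k, wellPoisedTerm a b c d e f q (b * mu / a) k =
      qPochInf (a * q) q * qPochInf b q * qPochInf (b * c * mu / a) q *
        qPochInf (b * d * mu / a) q * qPochInf (b * e * mu / a) q * qPochInf (b * f * mu / a) q *
        ∑' k, wellPoisedTerm mu (a * q / (b * c)) (a * q / (b * d)) (a * q / (b * e))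
          (a * q / (b * f)) (b * mu / a) q b k := by
  have hR' : ∀ l : List ℂ, [a * q / (b * c), a * q / (b * d), a * q / (b * e),
      a * q / (b * f)] ⊆ l → ‖b‖ < 1 ∨ HasTerminator q l := fun l hl => by
    refine hR.imp id ?_
    rintro ⟨y, hy, m, hm⟩
    exact ⟨y, hl hy, m, hm⟩
  rcases hL with hL | ⟨y, hy, m, hm⟩
  · exact second_transformation_of_terminator hq0 hq ha hb hc hd he hf hmu h1 h2 h3 h4 h5 h6 h7 h8
      h9 (Or.inl hL) hR
  simp only [List.mem_cons, List.not_mem_nil, or_false] at hy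
  rcases hy with hy | hy | hy | hy | hy
  · exact second_transformation_of_terminator hq0 hq ha hb hc hd he hf hmu h1 h2 h3 h4 h5 h6 h7 h8
      h9 (Or.inr ⟨y, by simp [hy], m, hm⟩) hR
  · have := second_transformation_of_terminator (c := d) (d := c) hq0 hq ha hb hd hc he hf
      (by rw [hmu]; ring) h1 h3 h2 h4 h5 h7 h6 h8 h9
      (Or.inr ⟨y, by simp [hy], m, hm⟩) (hR' _ (by intro x; simp; tauto))
    have s1 : ∀ k, wellPoisedTerm a b d c e f q (b * mu / a) k =
        wellPoisedTerm a b c d e f q (b * mu / a) k := fun k => by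
      simp only [wellPoisedTerm, div_eq_mul_inv, mul_inv]; ring
    have s2 : ∀ k, wellPoisedTerm mu (a * q / (b * d)) (a * q / (b * c)) (a * q / (b * e))
          (a * q / (b * f)) (b * mu / a) q b k =
        wellPoisedTerm mu (a * q / (b * c)) (a * q / (b * d)) (a * q / (b * e))
          (a * q / (b * f)) (b * mu / a) q b k := fun k => by
      simp only [wellPoisedTerm, div_eq_mul_inv, mul_inv]; ring
    simp only [s1, s2] at this
    linear_combination this
  · exact second_transformation_of_terminator hq0 hq ha hb hc hd he hf hmu h1 h2 h3 h4 h5 h6 h7 h8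
      h9 (Or.inr ⟨y, by simp [hy], m, hm⟩) hR
  · have := second_transformation_of_terminator (d := e) (e := d) hq0 hq ha hb hc he hd hf
      (by rw [hmu]; ring) h1 h2 h4 h3 h5 h6 h8 h7 h9
      (Or.inr ⟨y, by simp [hy], m, hm⟩) (hR' _ (by intro x; simp; tauto))
    have s1 : ∀ k, wellPoisedTerm a b c e d f q (b * mu / a) k =
        wellPoisedTerm a b c d e f q (b * mu / a) k := fun k => by
      simp only [wellPoisedTerm, div_eq_mul_inv, mul_inv]; ring
    have s2 : ∀ k, wellPoisedTerm mu (a * q / (b * c)) (a * q / (b * e)) (a * q / (b * d))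
          (a * q / (b * f)) (b * mu / a) q b k =
        wellPoisedTerm mu (a * q / (b * c)) (a * q / (b * d)) (a * q / (b * e))
          (a * q / (b * f)) (b * mu / a) q b k := fun k => by
      simp only [wellPoisedTerm, div_eq_mul_inv, mul_inv]; ring
    simp only [s1, s2] at this
    linear_combination this
  · have := second_transformation_of_terminator (d := f) (f := d) hq0 hq ha hb hc hf he hd
      (by rw [hmu]; ring) h1 h2 h5 h4 h3 h6 h9 h8 h7
      (Or.inr ⟨y, by simp [hy], m, hm⟩) (hR' _ (by intro x; simp; tauto))
    have s1 : ∀ k, wellPoisedTerm a b c f e d q (b * mu / a) k =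
        wellPoisedTerm a b c d e f q (b * mu / a) k := fun k => by
      simp only [wellPoisedTerm, div_eq_mul_inv, mul_inv]; ring
    have s2 : ∀ k, wellPoisedTerm mu (a * q / (b * c)) (a * q / (b * f)) (a * q / (b * e))
          (a * q / (b * d)) (b * mu / a) q b k =
        wellPoisedTerm mu (a * q / (b * c)) (a * q / (b * d)) (a * q / (b * e))
          (a * q / (b * f)) (b * mu / a) q b k := fun k => by
      simp only [wellPoisedTerm, div_eq_mul_inv, mul_inv]; ring
    simp only [s1, s2] at this
    linear_combination this

end SecondTransformation

/-! ### From the ₈φ₇ notation to well-poised terms, and the meaning of convergence. -/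

section Phi

variable {q a b c d e f r b' c' d' e' f' z : ℂ}

/-- The factorials of `±q√a` over those of `±√a` collapse to `(1 - a q^{2k}) / (1 - a)`. Here `a ≠
1`, since the lower parameters `±√a` differ from `1`. -/
theorem phiTerm_eq_wellPoisedTerm (hr : r ^ 2 = a) (h1 : ∀ n : ℕ, r * q ^ n ≠ 1)
    (h2 : ∀ n : ℕ, -r * q ^ n ≠ 1) (hb : a * q / b = b') (hc : a * q / c = c')
    (hd : a * q / d = d') (he : a * q / e = e') (hf : a * q / f = f') (k : ℕ) :
    phiTerm [a, q * r, -(q * r), b, c, d, e, f] [r, -r, b', c', d', e', f'] q z k =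
      wellPoisedTerm a b c d e f q z k := by
  have p1 := qPoch_ne_zero h1 k
  have p2 := qPoch_ne_zero h2 k
  have s1 : qPoch (q * r) q k * (1 - r) = qPoch r q k * (1 - r * q ^ k) := by
    rw [← qPoch_succ, qPoch_succ_left, mul_comm q r]; ring
  have s2 : qPoch (-(q * r)) q k * (1 - -r) = qPoch (-r) q k * (1 - -r * q ^ k) := by
    rw [← qPoch_succ, qPoch_succ_left, show -(q * r) = -r * q by ring]; ring
  have s3 := qPoch_mul_self_eq q a k
  have n1 : 1 - r ≠ 0 := by simpa using sub_ne_zero.2 (h1 0).symm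
  have n2 : 1 - -r ≠ 0 := by simpa using sub_ne_zero.2 (h2 0).symm
  have n3 : (1 - r) * (1 - -r) = 1 - a := by rw [← hr]; ring
  have n4 : (1 - r * q ^ k) * (1 - -r * q ^ k) = 1 - a * q ^ (2 * k) := by rw [← hr]; ring
  have key : qPoch a q k * qPoch (q * r) q k * qPoch (-(q * r)) q k =
      qPoch r q k * qPoch (-r) q k * vwp a q k := by
    refine mul_right_cancel₀ (mul_ne_zero n1 n2) ?_
    calc _ = qPoch a q k * (qPoch (q * r) q k * (1 - r)) *
          (qPoch (-(q * r)) q k * (1 - -r)) := by ring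
      _ = qPoch a q k * ((1 - r * q ^ k) * (1 - -r * q ^ k)) * (qPoch r q k * qPoch (-r) q k) := by
          rw [s1, s2]; ring
      _ = _ := by rw [n4, s3, n3]; ring
  rw [wellPoisedTerm, hb, hc, hd, he, hf]
  simp only [phiTerm, qPochs, List.map_cons, List.map_nil, List.prod_cons, List.prod_nil,
    List.length_cons, List.length_nil, mul_one]
  -- The exponent of `(-1)^k q^{k(k-1)/2}` is `7 - 8 + 1 = 0`.
  norm_num
  calc _ = (qPoch a q k * qPoch (q * r) q k * qPoch (-(q * r)) q k) /
        (qPoch r q k * qPoch (-r) q k) * (qPoch b q k * qPoch c q k * qPoch d q k * qPoch e q k *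
          qPoch f q k * z ^ k / (qPoch q q k * qPoch b' q k * qPoch c' q k * qPoch d' q k *
            qPoch e' q k * qPoch f' q k)) := by
        simp only [div_eq_mul_inv, mul_inv]; ring
    _ = _ := by
        rw [key, mul_div_cancel_left₀ _ (mul_ne_zero p1 p2)]
        simp only [div_eq_mul_inv]; ring

-- If `|z| ≥ 1`, then `|g k| ≤ |g k z^k| → 0`, which contradicts the nonzero limit.
open Filter Topology in
theorem norm_lt_one_of_summable_mul_pow {g : ℕ → ℂ} {L : ℂ} (hL : L ≠ 0)
    (hg : Tendsto g atTop (𝓝 L)) (hs : Summable fun k => g k * z ^ k) : ‖z‖ < 1 := by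
  by_contra! h
  have h0 : Tendsto g atTop (𝓝 0) := by
    refine squeeze_zero_norm (fun k => ?_) (by simpa using hs.tendsto_atTop_zero.norm)
    exact le_mul_of_one_le_right (norm_nonneg _) (one_le_pow₀ h)
  exact hL (tendsto_nhds_unique hg h0)

open Filter Topology in
theorem tendsto_vwp (hq : ‖q‖ < 1) (a : ℂ) :
    Tendsto (vwp a q) atTop (𝓝 (qPochInf (a * q) q)) := by
  rw [← tendsto_add_atTop_iff_nat 1]
  simp only [vwp_succ]
  have h1 : Tendsto (fun k : ℕ => q ^ (2 * k + 2)) atTop (𝓝 0) :=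
    (tendsto_pow_atTop_nhds_zero_of_norm_lt_one hq).comp
      (tendsto_atTop_mono (f := id) (fun k => show k ≤ 2 * k + 2 by omega) tendsto_id)
  simpa using ((h1.const_mul a).const_sub 1).mul (tendsto_qPoch hq (a * q))

/-- Without a terminating parameter, the coefficient of `z ^ k` tends to a quotient of nonzero
infinite products. -/
theorem norm_lt_one_or_hasTerminator (hq : ‖q‖ < 1)
    (h1 : ∀ n : ℕ, a * q / b * q ^ n ≠ 1) (h2 : ∀ n : ℕ, a * q / c * q ^ n ≠ 1)
    (h3 : ∀ n : ℕ, a * q / d * q ^ n ≠ 1) (h4 : ∀ n : ℕ, a * q / e * q ^ n ≠ 1)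
    (h5 : ∀ n : ℕ, a * q / f * q ^ n ≠ 1) (hs : Summable (wellPoisedTerm a b c d e f q z)) :
    ‖z‖ < 1 ∨ HasTerminator q [a * q, b, c, d, e, f] := by
  by_cases ht : HasTerminator q [a * q, b, c, d, e, f]
  · exact Or.inr ht
  left
  have nz : ∀ x ∈ [a * q, b, c, d, e, f], qPochInf x q ≠ 0 := fun x hx =>
    (qPochInf_ne_zero_iff hq).2 fun n hn => ht ⟨x, hx, n, hn⟩
  have l := fun {x : ℂ} (hx : ∀ n : ℕ, x * q ^ n ≠ 1) => (qPochInf_ne_zero_iff hq).2 hx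
  have T := tendsto_qPoch hq
  have l0 := l (mul_pow_ne_one_self hq)
  have lim := ((((((tendsto_vwp hq a).mul (T b)).mul (T c)).mul (T d)).mul (T e)).mul (T f)).div
    ((((((T q).mul (T (a * q / b))).mul (T (a * q / c))).mul (T (a * q / d))).mul
      (T (a * q / e))).mul (T (a * q / f)))
    (mul_ne_zero (mul_ne_zero (mul_ne_zero (mul_ne_zero (mul_ne_zero l0 (l h1)) (l h2)) (l h3))
      (l h4)) (l h5))
  refine norm_lt_one_of_summable_mul_pow ?_ lim (hs.congr fun k => ?_)
  · refine div_ne_zero ?_ (mul_ne_zero (mul_ne_zero (mul_ne_zero (mul_ne_zero (mul_ne_zero l0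
      (l h1)) (l h2)) (l h3)) (l h4)) (l h5))
    refine mul_ne_zero (mul_ne_zero (mul_ne_zero (mul_ne_zero (mul_ne_zero ?_ ?_) ?_) ?_) ?_) ?_
    all_goals exact nz _ (by simp)
  · rw [wellPoisedTerm]
    simp only [Pi.div_apply]
    ring

theorem phi_eq_tsum_wellPoisedTerm (hq : ‖q‖ < 1) (hr : r ^ 2 = a)
    (hb : a * q / b = b') (hc : a * q / c = c')
    (hd : a * q / d = d') (he : a * q / e = e') (hf : a * q / f = f')
    (h : PhiConverges [a, q * r, -(q * r), b, c, d, e, f] [r, -r, b', c', d', e', f'] q z) :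
    phi [a, q * r, -(q * r), b, c, d, e, f] [r, -r, b', c', d', e', f'] q z =
        ∑' k, wellPoisedTerm a b c d e f q z k ∧
      (‖z‖ < 1 ∨ HasTerminator q [a * q, b, c, d, e, f]) := by
  obtain ⟨hl, hs⟩ := h
  have e1 : ∀ k, phiTerm [a, q * r, -(q * r), b, c, d, e, f] [r, -r, b', c', d', e', f'] q z k =
      wellPoisedTerm a b c d e f q z k :=
    phiTerm_eq_wellPoisedTerm hr (hl _ (by simp)) (hl _ (by simp)) hb hc hd he hf
  refine ⟨tsum_congr e1, norm_lt_one_or_hasTerminator hq ?_ ?_ ?_ ?_ ?_ (hs.congr e1)⟩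
  · rw [hb]; exact hl _ (by simp)
  · rw [hc]; exact hl _ (by simp)
  · rw [hd]; exact hl _ (by simp)
  · rw [he]; exact hl _ (by simp)
  · rw [hf]; exact hl _ (by simp)

end Phi

/-- The two transformations of the very-well-poised `₈φ₇` series of argument `a²q²/(bcdef)`;
`ra`, `rl`, `rm` are arbitrary square roots of `a`, `lam`, `mu`. -/
theorem mainTheorem7 (q a b c d e f lam mu ra rl rm : ℂ)
    (hq0 : q ≠ 0) (hq1 : ‖q‖ < 1)
    (ha : a ≠ 0) (hb : b ≠ 0) (hc : c ≠ 0) (hd : d ≠ 0) (he : e ≠ 0) (hf : f ≠ 0)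
    (hlam : lam = q * a ^ 2 / (b * c * d))
    (hmu : mu = q ^ 2 * a ^ 3 / (b ^ 2 * c * d * e * f))
    (hra : ra ^ 2 = a) (hrl : rl ^ 2 = lam) (hrm : rm ^ 2 = mu)
    -- the left-hand series is meaningful and converges
    (hL : PhiConverges
      [a, q * ra, -(q * ra), b, c, d, e, f]
      [ra, -ra, a * q / b, a * q / c, a * q / d, a * q / e, a * q / f]
      q (a ^ 2 * q ^ 2 / (b * c * d * e * f))) :
    -- first transformation
    (PhiConverges
        [lam, q * rl, -(q * rl), lam * b / a, lam * c / a, lam * d / a, e, f]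
        [rl, -rl, a * q / b, a * q / c, a * q / d, lam * q / e, lam * q / f]
        q (a * q / (e * f)) →
      qPochInfs [a * q / e, a * q / f, lam * q, lam * q / (e * f)] q ≠ 0 →
      phi
        [a, q * ra, -(q * ra), b, c, d, e, f]
        [ra, -ra, a * q / b, a * q / c, a * q / d, a * q / e, a * q / f]
        q (a ^ 2 * q ^ 2 / (b * c * d * e * f)) =
      qPochInfs [a * q, a * q / (e * f), lam * q / e, lam * q / f] q /
          qPochInfs [a * q / e, a * q / f, lam * q, lam * q / (e * f)] q *
        phi
          [lam, q * rl, -(q * rl), lam * b / a, lam * c / a, lam * d / a, e, f]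
          [rl, -rl, a * q / b, a * q / c, a * q / d, lam * q / e, lam * q / f]
          q (a * q / (e * f))) ∧
    -- second transformation
    (PhiConverges
        [mu, q * rm, -(q * rm), a * q / (b * c), a * q / (b * d), a * q / (b * e),
          a * q / (b * f), b * mu / a]
        [rm, -rm, b * c * mu / a, b * d * mu / a, b * e * mu / a, b * f * mu / a, a * q / b]
        q b →
      qPochInfs [a * q / c, a * q / d, a * q / e, a * q / f, mu * q, b * mu / a] q ≠ 0 →
      phi
        [a, q * ra, -(q * ra), b, c, d, e, f]
        [ra, -ra, a * q / b, a * q / c, a * q / d, a * q / e, a * q / f]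
        q (a ^ 2 * q ^ 2 / (b * c * d * e * f)) =
      qPochInfs [a * q, b, b * c * mu / a, b * d * mu / a, b * e * mu / a, b * f * mu / a] q /
          qPochInfs [a * q / c, a * q / d, a * q / e, a * q / f, mu * q, b * mu / a] q *
        phi
          [mu, q * rm, -(q * rm), a * q / (b * c), a * q / (b * d), a * q / (b * e),
            a * q / (b * f), b * mu / a]
          [rm, -rm, b * c * mu / a, b * d * mu / a, b * e * mu / a, b * f * mu / a, a * q / b]
          q b) := by
  have hmu0 : mu ≠ 0 := by rw [hmu]; positivity
  have hl0 : lam ≠ 0 := by rw [hlam]; positivity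
  have hl := hL.1
  have l1 : ∀ n : ℕ, a * q / b * q ^ n ≠ 1 := hl _ (by simp)
  have l2 : ∀ n : ℕ, a * q / c * q ^ n ≠ 1 := hl _ (by simp)
  have l3 : ∀ n : ℕ, a * q / d * q ^ n ≠ 1 := hl _ (by simp)
  have l4 : ∀ n : ℕ, a * q / e * q ^ n ≠ 1 := hl _ (by simp)
  have l5 : ∀ n : ℕ, a * q / f * q ^ n ≠ 1 := hl _ (by simp)
  obtain ⟨eL, tL⟩ := phi_eq_tsum_wellPoisedTerm hq1 hra rfl rfl rfl rfl rfl hL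
  rw [eL]
  constructor
  · intro hR hD
    obtain ⟨eR, tR⟩ := phi_eq_tsum_wellPoisedTerm hq1 hrl (by field_simp) (by field_simp)
      (by field_simp) rfl rfl hR
    have hr := hR.1
    have z1 : a ^ 2 * q ^ 2 / (b * c * d * e * f) = lam * q / (e * f) := by
      rw [hlam]; field_simp
    simp only [qPochInfs, List.map_cons, List.map_nil, List.prod_cons, List.prod_nil, mul_one,
      ne_eq, mul_eq_zero, not_or] at hD ⊢
    obtain ⟨-, -, d3, d4⟩ := hD
    rw [eR, z1, tsum_wellPoisedTerm_transformation hq0 hq1 ha hb hc hd he hf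
      (by rw [hlam]; field_simp) l1 l2 l3 ((qPochInf_ne_zero_iff hq1).1 d3) l4 (hr _ (by simp)) l5
      (hr _ (by simp)) ((qPochInf_ne_zero_iff hq1).1 d4) (by rwa [z1] at tL) tR]
    simp only [mul_assoc]
  · intro hR hD
    obtain ⟨eR, tR⟩ := phi_eq_tsum_wellPoisedTerm hq1 hrm (by field_simp) (by field_simp)
      (by field_simp) (by field_simp) (by field_simp) hR
    have hr := hR.1
    have z1 : a ^ 2 * q ^ 2 / (b * c * d * e * f) = b * mu / a := by
      rw [hmu]; field_simp
    simp only [qPochInfs, List.map_cons, List.map_nil, List.prod_cons, List.prod_nil, mul_one,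
      ne_eq, mul_eq_zero, not_or] at hD ⊢
    obtain ⟨d1, d2, d3, d4, d5, d6⟩ := hD
    rw [z1] at tL ⊢
    -- Termination through `mu * q` or `b * mu / a` is excluded, because both infinite products
    -- stand in the nonzero denominator of the prefactor.
    have tR' : ‖b‖ < 1 ∨ HasTerminator q
        [a * q / (b * c), a * q / (b * d), a * q / (b * e), a * q / (b * f)] := by
      refine tR.imp id ?_
      rintro ⟨x, hx, m, hm⟩
      simp only [List.mem_cons, List.not_mem_nil, or_false] at hx
      rcases hx with h | h | h | h | h | h
      · rw [h] at hm
        exact absurd hm ((qPochInf_ne_zero_iff hq1).1 d5 m)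
      iterate 4 exact ⟨x, by simp [h], m, hm⟩
      · rw [h] at hm
        exact absurd hm ((qPochInf_ne_zero_iff hq1).1 d6 m)
    -- If `b` terminated the left series, then `|b| ≥ 1`, so the right series would terminate
    -- through some `aq/(by)` with `y` among `c, d, e, f`. Multiplying the two relations would make
    -- the lower parameter `aq/y` a power `q^{-(m+n)}`.
    have hbt : ∀ n : ℕ, b * q ^ n ≠ 1 := by
      intro n hn
      rcases tR' with h | ⟨x, hx, m, hm⟩
      · exact mul_pow_ne_one_of_norm_lt hq1 h n hn
      have aux : ∀ y, y ≠ 0 → x = a * q / (b * y) → a * q / y * q ^ (m + n) = 1 := by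
        rintro y hy rfl
        calc a * q / y * q ^ (m + n) = (a * q / (b * y) * q ^ m) * (b * q ^ n) := by
              rw [pow_add]; field_simp
          _ = 1 := by rw [hm, hn, one_mul]
      simp only [List.mem_cons, List.not_mem_nil, or_false] at hx
      rcases hx with h | h | h | h
      · exact l2 _ (aux c hc h)
      · exact l3 _ (aux d hd h)
      · exact l4 _ (aux e he h)
      · exact l5 _ (aux f hf h)
    have tL' : ‖b * mu / a‖ < 1 ∨ HasTerminator q [a * q, c, d, e, f] := by
      refine tL.imp id ?_
      rintro ⟨x, hx, m, hm⟩
      simp only [List.mem_cons, List.not_mem_nil, or_false] at hx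
      rcases hx with h | h | h
      · exact ⟨x, by simp [h], m, hm⟩
      · rw [h] at hm
        exact absurd hm (hbt m)
      · exact ⟨x, by simp [h], m, hm⟩
    have B := second_transformation_of_terminators hq0 hq1 ha hb hc hd he hf hmu l1 l2 l3 l4 l5
      (hr _ (by simp)) (hr _ (by simp)) (hr _ (by simp)) (hr _ (by simp)) tL' tR'
    rw [eR, div_mul_eq_mul_div, eq_div_iff (mul_ne_zero d1 (mul_ne_zero d2 (mul_ne_zero d3
      (mul_ne_zero d4 (mul_ne_zero d5 d6)))))]
    linear_combination B
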